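/- Let $\Bbbk$ be an algebraically closed field of characteristic zero, let $n\ge 2$, $N=2n$, and let $q\in\Bbbk$ be a primitive $N$-th root of unity. Let $\mathrm{u}_q=\mathrm{u}_q(\mathfrak{sl}_{2,\mathbb I})$, $\mathbb I=\{1,2\}$, be the Hopf algebra generated as a $\Bbbk$-algebra by $x_1,x_2,y_1,y_2,\kappa_1,\kappa_2$ with relations $$\kappa_ix_i=qx_i\kappa_i,\quad \kappa_iy_i=q^{-1}y_i\kappa_i,\quad \kappa_ix_j=x_j\kappa_i,\quad \kappa_iy_j=y_j\kappa_i\ (i\ne j),\quad \kappa_1\kappa_2=\kappa_2\kappa_1,\quad \kappa_i^N=1,$$ $$y_ix_j-q_{ji}x_jy_i=\delta_{ij}(1-\bar\gamma_i\gamma_i),\qquad q_{11}=q_{22}=-1,\ q_{12}=q,\ q_{21}=1,$$ $$x_i^2=y_i^2=0,\qquad (x_1x_2-qx_2x_1)^N=(y_1y_2-qy_2y_1)^N=0,$$ where $\gamma_1=\kappa_1^n\kappa_2$, $\gamma_2=\kappa_2^n$, $\bar\gamma_1=\kappa_1^n$, $\bar\gamma_2=\kappa_1\kappa_2^n$ (so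 $\bar\gamma_1\gamma_1=\kappa_2$ and $\bar\gamma_2\gamma_2=\kappa_1$), and with counit $\varepsilon(x_i)=\varepsilon(y_i)=0$, $\varepsilon(\kappa_i)=1$. Put $\Lambda=(\mathbb Z/N)^2$. A vector $v$ of a module has weight $(a,b)\in\Lambda$ if $\kappa_1v=q^av$ and $\kappa_2v=q^bv$. For $(i,j)\in\Lambda$ let $M(i,j)$ be the module induced from the one-dimensional module of weight $(i,j)$, with $x_1,x_2$ acting by zero, over the positive Borel part $\mathrm u_q^+$ (generated by the $x_i,\kappa_i$), and let $L(i,j)$ be the quotient of $M(i,j)$ by its unique maximal submodule. A weight diagram is a finite directed graph with vertices labelled by elements of $\Lambda$ and edges labelled by $1$ or $2$. A module is *given by* such a diagram if it has a basis indexed by the vertices such that each basis vector has the weight of its label; the basis vector of the left-most vertex is annihilated by $x_1,x_2$ and generates the module; and $y_a$ maps a basis vector to a nonzero multiple of the basis vector at the end of the edge of label $a$ leaving its vertex, and to zero if there is no such edge. **Theorem.** The modules $L(i,j)$, $(i,j)\in\Lambda$, are simple and pairwise non-isomorphic, and every simple $\mathrm u_q$-module is isomorphic to one of them. They are described as follows.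 1. $L(0,0)$ is the tensor unit ($\Bbbk$ with $\mathrm u_q$ acting through $\varepsilon$). It is the unique one-dimensional $\mathrm u_q$-module up to isomorphism, given by the diagram with a single vertex $(0,0)$ and no edges. 2. For $0<j<N$, $L(0,j)$ has dimension $2j+1$ and is given by the path $$(0,j)\xrightarrow{1}(-1,j)\xrightarrow{2}(-1,j-1)\xrightarrow{1}\cdots\xrightarrow{2}(-j+1,1)\xrightarrow{1}(-j,1)\xrightarrow{2}(-j,0).$$ 3. For $0<i<N$, $L(i,0)$ has dimension $2i+1$ and is given by the path $$(i,0)\xrightarrow{2}(i,-1)\xrightarrow{1}(i-1,-1)\xrightarrow{2}\cdots\xrightarrow{1}(1,-i+1)\xrightarrow{2}(1,-i)\xrightarrow{1}(0,-i).$$ 4. For $0<i,j<N$, let $k$ be the unique integer with $1\le k\le N$ and $k\equiv i+j \pmod N$. Then $L(i,j)$ has dimension $4k$ and is given by the diagram that consists of the two paths $$(i,j)\xrightarrow{2}(i,j-1)\xrightarrow{1}(i-1,j-1)\xrightarrow{2}\cdots\xrightarrow{1}(i-k+1,j-k+1)\xrightarrow{2}(i-k+1,j-k)\xrightarrow{1}(i-k,j-k),$$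 $$(i,j)\xrightarrow{1}(i-1,j)\xrightarrow{2}(i-1,j-1)\xrightarrow{1}\cdots\xrightarrow{2}(i-k+1,j-k+1)\xrightarrow{1}(i-k,j-k+1)\xrightarrow{2}(i-k,j-k),$$ with $2k$ edges each, which share exactly their first and their last vertex; here $(i-k,j-k)=(-j,-i)$. In particular, if $i+j=N$, then $L(i,j)=M(i,j)$, that is, the projection $M(i,j)\to L(i,j)$ is an isomorphism. -/

import Mathlib

open scoped TensorProduct

universe u v

namespace SuperA

/-! ## The algebra `u_q(sl_{2,I})`

The indices `1, 2` of the mathematics are `0, 1 : Fin 2` here, and `N = 2 * n` is the order of `q`. -/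

/-- The generators `x_i`, `y_i`, `κ_i` (`i = 1, 2`). -/
inductive Gen : Type
  | x (i : Fin 2)
  | y (i : Fin 2)
  | κ (i : Fin 2)

section Relations

variable {k : Type u} [Field k]

/-- The exponents `u_{ij}` with `q_{ij} = q ^ u_{ij}`, for the braiding matrix
`q_{11} = q_{22} = -1 = q ^ n`, `q_{12} = q`, `q_{21} = 1`. -/
def uMat (n : ℕ) (i j : Fin 2) : ℕ := if i = j then n else if i < j then 1 else 0

/-- The generator `x_i` in the free algebra. -/
def fx (k : Type u) [Field k] (i : Fin 2) : FreeAlgebra k Gen := FreeAlgebra.ι k (Gen.x i)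

/-- The generator `y_i` in the free algebra. -/
def fy (k : Type u) [Field k] (i : Fin 2) : FreeAlgebra k Gen := FreeAlgebra.ι k (Gen.y i)

/-- The generator `κ_i` in the free algebra. -/
def fκ (k : Type u) [Field k] (i : Fin 2) : FreeAlgebra k Gen := FreeAlgebra.ι k (Gen.κ i)

/-- `γ_1 = κ_1 ^ u_{11} κ_2 ^ u_{12}` and `γ_2 = κ_2 ^ u_{22}`. -/
def fγ (k : Type u) [Field k] (n : ℕ) (i : Fin 2) : FreeAlgebra k Gen :=
  if i = 0 then fκ k 0 ^ uMat n 0 0 * fκ k 1 ^ uMat n 0 1 else fκ k 1 ^ uMat n 1 1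

/-- `γ̄_1 = κ_1 ^ u_{11}` and `γ̄_2 = κ_1 ^ u_{12} κ_2 ^ u_{22}`. -/
def fγbar (k : Type u) [Field k] (n : ℕ) (i : Fin 2) : FreeAlgebra k Gen :=
  if i = 0 then fκ k 0 ^ uMat n 0 0 else fκ k 0 ^ uMat n 0 1 * fκ k 1 ^ uMat n 1 1

/-- The defining relations of `u_q(sl_{2,I})`. The only even positive root is `α_1 + α_2`, with root
vectors the `q`-commutators `x_{12} = x_1 x_2 - q_{12} x_2 x_1`, `y_{12} = y_1 y_2 - q_{12} y_2 y_1`. -/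
inductive Rel (q : k) (n : ℕ) : FreeAlgebra k Gen → FreeAlgebra k Gen → Prop
  | κ_x_same (i : Fin 2) : Rel q n (fκ k i * fx k i) (q • (fx k i * fκ k i))
  | κ_x_ne (i j : Fin 2) : i ≠ j → Rel q n (fκ k i * fx k j) (fx k j * fκ k i)
  | κ_y_same (i : Fin 2) : Rel q n (fκ k i * fy k i) (q⁻¹ • (fy k i * fκ k i))
  | κ_y_ne (i j : Fin 2) : i ≠ j → Rel q n (fκ k i * fy k j) (fy k j * fκ k i)
  | κ_comm (i j : Fin 2) : Rel q n (fκ k i * fκ k j) (fκ k j * fκ k i)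
  | κ_pow (i : Fin 2) : Rel q n (fκ k i ^ (2 * n)) 1
  | y_x_same (i : Fin 2) :
      Rel q n (fy k i * fx k i - q ^ uMat n i i • (fx k i * fy k i)) (1 - fγbar k n i * fγ k n i)
  | y_x_ne (i j : Fin 2) : i ≠ j →
      Rel q n (fy k i * fx k j - q ^ uMat n j i • (fx k j * fy k i)) 0
  | x_sq (i : Fin 2) : Rel q n (fx k i ^ 2) 0
  | y_sq (i : Fin 2) : Rel q n (fy k i ^ 2) 0
  | x12_pow :
      Rel q n ((fx k 0 * fx k 1 - q ^ uMat n 0 1 • (fx k 1 * fx k 0)) ^ (2 * n)) 0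
  | y12_pow :
      Rel q n ((fy k 0 * fy k 1 - q ^ uMat n 0 1 • (fy k 1 * fy k 0)) ^ (2 * n)) 0

/-- The `k`-algebra `u_q = u_q(sl_{2,I})`. -/
def Uq (q : k) (n : ℕ) : Type u := RingQuot (Rel q n)

instance (q : k) (n : ℕ) : Ring (Uq q n) := inferInstanceAs (Ring (RingQuot (Rel q n)))

instance (q : k) (n : ℕ) : Algebra k (Uq q n) := inferInstanceAs (Algebra k (RingQuot (Rel q n)))

/-- The quotient map from the free algebra. -/
def Uq.mk (q : k) (n : ℕ) : FreeAlgebra k Gen →ₐ[k] Uq q n := RingQuot.mkAlgHom k (Rel q n)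

/-- The generator `x_i` of `u_q`. -/
def Uq.x (q : k) (n : ℕ) (i : Fin 2) : Uq q n := Uq.mk q n (fx k i)

/-- The generator `y_i` of `u_q`. -/
def Uq.y (q : k) (n : ℕ) (i : Fin 2) : Uq q n := Uq.mk q n (fy k i)

/-- The generator `κ_i` of `u_q`. -/
def Uq.κ (q : k) (n : ℕ) (i : Fin 2) : Uq q n := Uq.mk q n (fκ k i)

theorem Uq.mk_rel (q : k) (n : ℕ) {a b : FreeAlgebra k Gen} (h : Rel q n a b) :
    Uq.mk q n a = Uq.mk q n b :=
  RingQuot.mkAlgHom_rel k h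

end Relations

/-! ## The counit and the tensor unit -/

section Counit

variable {k : Type u} [Field k]

/-- The values of the counit on the generators. -/
def counitGen (k : Type u) [Field k] : Gen → k
  | Gen.x _ => 0
  | Gen.y _ => 0
  | Gen.κ _ => 1

/-- The counit `ε` of `u_q`: `ε(x_i) = ε(y_i) = 0`, `ε(κ_i) = 1`. -/
def counit {n : ℕ} (hn : 1 < n) (q : k) : Uq q n →ₐ[k] k :=
  RingQuot.liftAlgHom k
    ⟨FreeAlgebra.lift k (counitGen k), by
      intro a b h
      have h2 : 2 * n ≠ 0 := by omega
      cases h <;> simp [fx, fy, fκ, fγ, fγbar, counitGen, h2] <;> split_ifs <;> simp [counitGen]⟩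

/-- The tensor unit of the category of `u_q`-modules: `k`, with `u_q` acting through the counit. -/
def TensorUnit {n : ℕ} (_hn : 1 < n) (_q : k) : Type u := k

instance {n : ℕ} (hn : 1 < n) (q : k) : AddCommGroup (TensorUnit hn q) :=
  inferInstanceAs (AddCommGroup k)

instance {n : ℕ} (hn : 1 < n) (q : k) : Module (Uq q n) (TensorUnit hn q) :=
  Module.compHom k (counit hn q).toRingHom

end Counit

/-! ## The positive Borel part and its one-dimensional modules -/

section Borel

variable {k : Type u} [Field k]

/-- The generators `x_i`, `κ_i` of the positive Borel part. -/
inductive BorelGen : Type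
  | x (i : Fin 2)
  | κ (i : Fin 2)

/-- The generator `x_i` in the free algebra on the Borel generators. -/
def bx (k : Type u) [Field k] (i : Fin 2) : FreeAlgebra k BorelGen :=
  FreeAlgebra.ι k (BorelGen.x i)

/-- The generator `κ_i` in the free algebra on the Borel generators. -/
def bκ (k : Type u) [Field k] (i : Fin 2) : FreeAlgebra k BorelGen :=
  FreeAlgebra.ι k (BorelGen.κ i)

/-- The relations of the bosonization of the Nichols algebra by the group algebra of
`K = ⟨κ_1, κ_2⟩`: those relations of `u_q` that involve only `x_i` and `κ_i`. -/
inductive BorelRel (q : k) (n : ℕ) : FreeAlgebra k BorelGen → FreeAlgebra k BorelGen → Prop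
  | κ_x_same (i : Fin 2) : BorelRel q n (bκ k i * bx k i) (q • (bx k i * bκ k i))
  | κ_x_ne (i j : Fin 2) : i ≠ j → BorelRel q n (bκ k i * bx k j) (bx k j * bκ k i)
  | κ_comm (i j : Fin 2) : BorelRel q n (bκ k i * bκ k j) (bκ k j * bκ k i)
  | κ_pow (i : Fin 2) : BorelRel q n (bκ k i ^ (2 * n)) 1
  | x_sq (i : Fin 2) : BorelRel q n (bx k i ^ 2) 0
  | x12_pow :
      BorelRel q n ((bx k 0 * bx k 1 - q ^ uMat n 0 1 • (bx k 1 * bx k 0)) ^ (2 * n)) 0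

/-- The positive Borel part `u_q⁺`, the bosonization of the Nichols algebra. -/
def Borel (q : k) (n : ℕ) : Type u := RingQuot (BorelRel q n)

instance (q : k) (n : ℕ) : Ring (Borel q n) := inferInstanceAs (Ring (RingQuot (BorelRel q n)))

instance (q : k) (n : ℕ) : Algebra k (Borel q n) :=
  inferInstanceAs (Algebra k (RingQuot (BorelRel q n)))

/-- The generators of `u_q⁺` inside `u_q`. -/
def borelGenToUq (q : k) (n : ℕ) : BorelGen → Uq q n
  | BorelGen.x i => Uq.x q n i
  | BorelGen.κ i => Uq.κ q n i

/-- The canonical map `u_q⁺ → u_q`, `x_i ↦ x_i`, `κ_i ↦ κ_i`. -/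
def borelToUq (q : k) (n : ℕ) : Borel q n →ₐ[k] Uq q n :=
  RingQuot.liftAlgHom k
    ⟨FreeAlgebra.lift k (borelGenToUq q n), by
      intro a b h
      cases h with
      | κ_x_same i => simpa [bx, bκ, borelGenToUq, Uq.x, Uq.κ] using Uq.mk_rel q n (Rel.κ_x_same i)
      | κ_x_ne i j hij =>
        simpa [bx, bκ, borelGenToUq, Uq.x, Uq.κ] using Uq.mk_rel q n (Rel.κ_x_ne i j hij)
      | κ_comm i j => simpa [bx, bκ, borelGenToUq, Uq.x, Uq.κ] using Uq.mk_rel q n (Rel.κ_comm i j)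
      | κ_pow i => simpa [bx, bκ, borelGenToUq, Uq.x, Uq.κ] using Uq.mk_rel q n (Rel.κ_pow i)
      | x_sq i => simpa [bx, bκ, borelGenToUq, Uq.x, Uq.κ] using Uq.mk_rel q n (Rel.x_sq i)
      | x12_pow => simpa [bx, bκ, borelGenToUq, Uq.x, Uq.κ] using Uq.mk_rel q n Rel.x12_pow⟩

/-- The image of `u_q⁺` in `u_q` is the subalgebra generated by the `x_i` and `κ_i`. -/
theorem borelToUq_range (q : k) (n : ℕ) :
    (borelToUq q n).range =
      Algebra.adjoin k (Set.range (Uq.x q n) ∪ Set.range (Uq.κ q n)) := by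
  have hsurj : Function.Surjective (RingQuot.mkAlgHom k (BorelRel q n)) :=
    RingQuot.mkAlgHom_surjective k _
  have hcomp : (borelToUq q n).comp (RingQuot.mkAlgHom k (BorelRel q n)) =
      FreeAlgebra.lift k (borelGenToUq q n) := by
    ext g
    exact (RingQuot.liftAlgHom_mkAlgHom_apply k (FreeAlgebra.lift k (borelGenToUq q n)) _
      (FreeAlgebra.ι k g)).trans rfl
  have h1 : (borelToUq q n).range = (FreeAlgebra.lift k (borelGenToUq q n)).range := by
    rw [← hcomp]
    ext z
    constructor
    · rintro ⟨w, rfl⟩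
      obtain ⟨t, rfl⟩ := hsurj w
      exact ⟨t, rfl⟩
    · rintro ⟨t, rfl⟩
      exact ⟨_, rfl⟩
  have h2 : Set.range (borelGenToUq q n) = Set.range (Uq.x q n) ∪ Set.range (Uq.κ q n) := by
    ext z
    constructor
    · rintro ⟨g, rfl⟩
      cases g with
      | x i => exact Or.inl ⟨i, rfl⟩
      | κ i => exact Or.inr ⟨i, rfl⟩
    · rintro (⟨i, rfl⟩ | ⟨i, rfl⟩)
      · exact ⟨BorelGen.x i, rfl⟩
      · exact ⟨BorelGen.κ i, rfl⟩
  rw [h1, ← h2, Algebra.adjoin_range_eq_range_freeAlgebra_lift]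

/-- The weight group `Λ = (ℤ/N)²`. -/
abbrev Weight (n : ℕ) : Type := Fin 2 → ZMod (2 * n)

/-- The character of the Borel part of weight `w` on generators. -/
def borelCharGen (q : k) {n : ℕ} (w : Weight n) : BorelGen → k
  | BorelGen.x _ => 0
  | BorelGen.κ i => q ^ (w i).val

/-- The inflation of the `K`-character `κ_i ↦ q ^ w_i` to `u_q⁺`, `x_i` acting by zero. -/
def borelChar {n : ℕ} (hn : 1 < n) {q : k} (hq : IsPrimitiveRoot q (2 * n)) (w : Weight n) :
    Borel q n →ₐ[k] k :=
  RingQuot.liftAlgHom k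
    ⟨FreeAlgebra.lift k (borelCharGen q w), by
      intro a b h
      have h2 : 2 * n ≠ 0 := by omega
      have h3 : ∀ m : ℕ, (q ^ m) ^ (2 * n) = 1 := by
        intro m
        rw [← pow_mul, mul_comm, pow_mul, hq.pow_eq_one, one_pow]
      cases h with
      | κ_pow i => simp [bκ, borelCharGen, h3]
      | x12_pow => simp only [map_pow, map_sub, map_mul, map_smul, map_zero, bx,
          FreeAlgebra.lift_ι_apply, borelCharGen, mul_zero, smul_zero, sub_zero, zero_pow h2]
      | _ => simp [bx, bκ, borelCharGen, mul_comm]⟩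

end Borel

/-! ## Standard modules and simple modules -/

section Modules

variable {k : Type u} [Field k]

/-- The relations `(a φ(b)) ⊗ m = a ⊗ (b m)` in `A ⊗_k W`. -/
def inducedRel {A B : Type u} [Ring A] [Algebra k A] [Ring B] [Algebra k B] (φ : B →ₐ[k] A)
    {W : Type u} [AddCommGroup W] [Module k W] (ρ : B →ₐ[k] Module.End k W) :
    Submodule A (A ⊗[k] W) :=
  Submodule.span A {t | ∃ (a : A) (b : B) (m : W), t = (a * φ b) ⊗ₜ[k] m - a ⊗ₜ[k] (ρ b m)}

/-- The induced module `A ⊗_B W` along `φ : B → A`, for a `B`-module `W` given by `ρ`. -/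
abbrev Induced {A B : Type u} [Ring A] [Algebra k A] [Ring B] [Algebra k B] (φ : B →ₐ[k] A)
    {W : Type u} [AddCommGroup W] [Module k W] (ρ : B →ₐ[k] Module.End k W) : Type u :=
  (A ⊗[k] W) ⧸ inducedRel φ ρ

/-- The one-dimensional `u_q⁺`-module of weight `w`, on the vector space `k`. -/
def borelRep {n : ℕ} (hn : 1 < n) {q : k} (hq : IsPrimitiveRoot q (2 * n)) (w : Weight n) :
    Borel q n →ₐ[k] Module.End k k :=
  (Algebra.lmul k k).comp (borelChar hn hq w)

/-- The standard module `M(w)`, induced from the one-dimensional `u_q⁺`-module of weight `w`. -/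
abbrev StdModule {n : ℕ} (hn : 1 < n) {q : k} (hq : IsPrimitiveRoot q (2 * n)) (w : Weight n) :
    Type u :=
  Induced (borelToUq q n) (borelRep hn hq w)

/-- The sum of all proper submodules; it is the unique maximal submodule as soon as it is proper. -/
def sumProper (R : Type u) [Ring R] (V : Type u) [AddCommGroup V] [Module R V] : Submodule R V :=
  sSup {P | P ≠ ⊤}

/-- `L(w)`: the quotient of `M(w)` by its maximal submodule. -/
abbrev SimpleHead {n : ℕ} (hn : 1 < n) {q : k} (hq : IsPrimitiveRoot q (2 * n)) (w : Weight n) :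
    Type u :=
  StdModule hn hq w ⧸ sumProper (Uq q n) (StdModule hn hq w)

end Modules

/-! ## Weight diagrams -/

/-- A weight diagram: a directed graph with a marked left-most vertex, vertices labelled by `Λ`, and
edges labelled by `1` or `2`, at most one edge of each label leaving a vertex; `next a p` is the end
of the edge of label `a` leaving `p`, if there is one. -/
structure WeightDiagram (n : ℕ) where
  Vertex : Type
  start : Vertex
  label : Vertex → Weight n
  next : Fin 2 → Vertex → Option Vertex

section Given

variable {k : Type u} [Field k]

/-- The `u_q`-module `V` is given by the diagram `D`: `V` has a basis indexed by the vertices, each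
basis vector has the weight of its label, the left-most one is annihilated by `x_1, x_2` and
generates `V`, and `y_a` maps a basis vector to a nonzero multiple of the one at the end of the edge
of label `a` leaving it, and to zero if there is no such edge. -/
def IsGivenBy (q : k) (n : ℕ) (V : Type u) [AddCommGroup V] [Module k V] [Module (Uq q n) V]
    (D : WeightDiagram n) : Prop :=
  ∃ b : Module.Basis D.Vertex k V,
    (∀ p i, Uq.κ q n i • b p = (q ^ (D.label p i).val) • b p) ∧
    (∀ i, Uq.x q n i • b D.start = 0) ∧
    Submodule.span (Uq q n) {b D.start} = ⊤ ∧
    (∀ a p p', D.next a p = some p' → ∃ c : k, c ≠ 0 ∧ Uq.y q n a • b p = c • b p') ∧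
    (∀ a p, D.next a p = none → Uq.y q n a • b p = 0)

end Given

/-- The `s`-th letter (counting from `0`) of the alternating sequence of labels starting with `a`. -/
def altLetter (a : Fin 2) (s : ℕ) : Fin 2 := if Even s then a else a + 1

/-- The weight reached from `w` after `s` steps along the alternating path starting with `a`, where
an edge of label `c` lowers the coordinate `c` of the weight by one. -/
def altWeight {n : ℕ} (w : Weight n) (a : Fin 2) (s : ℕ) : Weight n :=
  fun c => w c - (((if c = a then (s + 1) / 2 else s / 2 : ℕ)) : ZMod (2 * n))

/-- The diagram that is a single alternating path with `l` edges, starting at the weight `w` with an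
edge of label `a`. -/
def chainDiagram {n : ℕ} (w : Weight n) (a : Fin 2) (l : ℕ) : WeightDiagram n where
  Vertex := Fin (l + 1)
  start := 0
  label p := altWeight w a p
  next c p :=
    if c = altLetter a p then
      if h : (p : ℕ) + 1 < l + 1 then some ⟨p + 1, h⟩ else none
    else none

/-- The vertices of the diagram with two alternating paths with common ends:
`branch a p` is the vertex reached after `p + 1` steps on the path starting with the label `a`. -/
inductive ForkVertex (m : ℕ) : Type
  | source
  | branch (a : Fin 2) (p : Fin (2 * m - 1))
  | sink

/-- The end of the edge of label `c` leaving a vertex of the diagram with two paths. -/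
def forkNext (m : ℕ) (hm : 1 ≤ m) (c : Fin 2) : ForkVertex m → Option (ForkVertex m)
  | ForkVertex.source => some (ForkVertex.branch c ⟨0, by omega⟩)
  | ForkVertex.branch a p =>
      if c = altLetter a (p + 1) then
        if h : (p : ℕ) + 1 < 2 * m - 1 then some (ForkVertex.branch a ⟨p + 1, h⟩)
        else some ForkVertex.sink
      else none
  | ForkVertex.sink => none

/-- The labels of the vertices of the diagram with two paths: the source has weight `w`, and the
sink has weight `(w_1 - m, w_2 - m)`. -/
def forkLabel {n : ℕ} (w : Weight n) (m : ℕ) : ForkVertex m → Weight n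
  | ForkVertex.source => w
  | ForkVertex.branch a p => altWeight w a (p + 1)
  | ForkVertex.sink => fun c => w c - (m : ZMod (2 * n))

/-- The diagram with `4 m` vertices made of the two alternating paths with `2 m` edges from the
weight `w`, one for each first label, which meet only in their first and last vertices. -/
def forkDiagram {n : ℕ} (w : Weight n) (m : ℕ) (hm : 1 ≤ m) : WeightDiagram n where
  Vertex := ForkVertex m
  start := ForkVertex.source
  label := forkLabel w m
  next := forkNext m hm

end SuperA

open SuperA

/-! Throughout, N = 2n. Since y_i^2 = 0, a word in the y_i acts nontrivially only if its letters
alternate. The cross terms in the power of y_1 y_2 - q y_2 y_1 vanish and (-q)^N = 1, so the last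
relation reads (y_1 y_2)^N = -(y_2 y_1)^N. Hence a module generated by a highest weight vector v is
spanned by v, the two alternating words of each length 1, ..., 2N-1, and one word of length 2N: at
most 4N vectors (`wordAct_eq_path`, `path_top`, `path_eq_zero`).

The y_i generate a nilpotent action, so Nakayama's lemma holds with V/(y_1 V + y_2 V) as head
(`eq_top_of_add_yImage`). It yields the general theory. The proper submodules of M(w) have a proper
sum; the weight w is read off from the line V/(y_1 V + y_2 V); and in a simple module a highest
weight vector inside y_1 V + y_2 V is zero. Conversely, the κ_i are diagonalizable because q is a
primitive N-th root of unity, and words in the x_i are nilpotent, so every nonzero module contains a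
highest weight vector (`exists_isHighest`). Thus every simple module is some L(w).

That M(w) is nonzero does not follow formally. It is obtained from an explicit model: alternating
words indexed by all integers, on which every relation holds except the one for y_12, whose N-th
power acts as a shift. A subquotient cut out between a half-line and its shift by N is a module with
a nonzero highest weight vector (`modelRep_rel`, `exists_module_with_isHighest`).

The shape of L(w) comes from the action of the x_i on alternating words. The decisive formula is
`IsHighest.x_smul_x_smul_path_odd`: lowering a word of length 2r+1 by two letters multiplies by (1 -
q^{-r})(1 - q^{i+j-r}). If a coordinate of w is zero, one of the two paths dies at its first step
and the other stops where the coefficient 1 - q^{j-r} vanishes. If both are nonzero, the paths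
survive until r = k ≡ i + j; there the 2 × 2 matrix of the x_i on the two words of length 2k is
singular, a combination of them is a highest weight vector, and simplicity makes them proportional.
For i + j = N this gives dimension 4N, the upper bound for M(w). -/

namespace SuperA

/-! ### Powers of q with exponents in ℤ/N -/

section Char

variable {k : Type u} [Field k] {q : k} {n : ℕ}

theorem pow_half_eq_neg_one (hn : 1 < n) (hq : IsPrimitiveRoot q (2 * n)) : q ^ n = -1 := by
  have h1 : (q ^ n) ^ 2 = 1 := by rw [← pow_mul, mul_comm, hq.pow_eq_one]
  rcases mul_self_eq_one_iff.mp (sq (q ^ n) ▸ h1) with h | h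
  · exact absurd h (hq.pow_ne_one_of_pos_of_lt (by omega) (by omega))
  · exact h

theorem pow_val_add (hn : 1 < n) (hq : IsPrimitiveRoot q (2 * n)) (a b : ZMod (2 * n)) :
    q ^ (a + b).val = q ^ a.val * q ^ b.val := by
  have : NeZero (2 * n) := ⟨by omega⟩
  rw [ZMod.val_add, ← pow_add]
  conv_rhs => rw [← Nat.mod_add_div (a.val + b.val) (2 * n), pow_add, pow_mul, hq.pow_eq_one,
    one_pow, mul_one]

theorem pow_val_natCast (hq : IsPrimitiveRoot q (2 * n)) (m : ℕ) :
    q ^ ((m : ZMod (2 * n))).val = q ^ m := by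
  rw [ZMod.val_natCast]
  conv_rhs => rw [← Nat.mod_add_div m (2 * n), pow_add, pow_mul, hq.pow_eq_one, one_pow, mul_one]

theorem pow_val_sub_natCast (hn : 1 < n) (hq : IsPrimitiveRoot q (2 * n)) (a : ZMod (2 * n))
    (m : ℕ) : q ^ (a - m).val = q ^ a.val * q⁻¹ ^ m := by
  have h0 : q ≠ 0 := hq.ne_zero (by omega)
  have h := pow_val_add hn hq (a - m) m
  rw [sub_add_cancel, pow_val_natCast hq] at h
  rw [h, mul_assoc, ← mul_pow, mul_inv_cancel₀ h0, one_pow, mul_one]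

theorem pow_val_sub_one (hn : 1 < n) (hq : IsPrimitiveRoot q (2 * n)) (a : ZMod (2 * n)) :
    q ^ (a - 1).val = q ^ a.val * q⁻¹ := by
  simpa using pow_val_sub_natCast hn hq a 1

theorem pow_val_injective (hn : 1 < n) (hq : IsPrimitiveRoot q (2 * n)) {a b : ZMod (2 * n)}
    (h : q ^ a.val = q ^ b.val) : a = b := by
  have : NeZero (2 * n) := ⟨by omega⟩
  exact ZMod.val_injective _ (hq.pow_inj (ZMod.val_lt a) (ZMod.val_lt b) h)

theorem pow_val_ne_one (hn : 1 < n) (hq : IsPrimitiveRoot q (2 * n)) {a : ZMod (2 * n)}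
    (h : a ≠ 0) : q ^ a.val ≠ 1 := by
  intro h1
  refine h (pow_val_injective hn hq (h1.trans ?_))
  simp

end Char

/-! ## Relations in `u_q` -/

section Relations

variable {k : Type u} [Field k] {q : k} {n : ℕ}

/-- The factor in `x_a y_b = exchangeFactor q a • y_b x_a` for `a ≠ b`. -/
def exchangeFactor (q : k) (a : Fin 2) : k := if a = 0 then q⁻¹ else 1

theorem exchangeFactor_mul (q : k) (a : Fin 2) :
    exchangeFactor q a * exchangeFactor q (a + 1) = q⁻¹ := by
  fin_cases a <;> simp [exchangeFactor]

theorem Uq.κ_mul_x_same (i : Fin 2) :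
    Uq.κ q n i * Uq.x q n i = q • (Uq.x q n i * Uq.κ q n i) := by
  simpa [Uq.x, Uq.κ] using Uq.mk_rel q n (Rel.κ_x_same i)

theorem Uq.κ_mul_x_ne {i j : Fin 2} (h : i ≠ j) :
    Uq.κ q n i * Uq.x q n j = Uq.x q n j * Uq.κ q n i := by
  simpa [Uq.x, Uq.κ] using Uq.mk_rel q n (Rel.κ_x_ne i j h)

theorem Uq.κ_mul_y_same (i : Fin 2) :
    Uq.κ q n i * Uq.y q n i = q⁻¹ • (Uq.y q n i * Uq.κ q n i) := by
  simpa [Uq.y, Uq.κ] using Uq.mk_rel q n (Rel.κ_y_same i)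

theorem Uq.κ_mul_y_ne {i j : Fin 2} (h : i ≠ j) :
    Uq.κ q n i * Uq.y q n j = Uq.y q n j * Uq.κ q n i := by
  simpa [Uq.y, Uq.κ] using Uq.mk_rel q n (Rel.κ_y_ne i j h)

theorem Uq.κ_comm (i j : Fin 2) : Uq.κ q n i * Uq.κ q n j = Uq.κ q n j * Uq.κ q n i := by
  simpa [Uq.κ] using Uq.mk_rel q n (Rel.κ_comm i j)

theorem Uq.κ_pow (i : Fin 2) : Uq.κ q n i ^ (2 * n) = 1 := by
  simpa [Uq.κ] using Uq.mk_rel q n (Rel.κ_pow i)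

theorem Uq.x_mul_self (i : Fin 2) : Uq.x q n i * Uq.x q n i = 0 := by
  simpa [Uq.x, sq] using Uq.mk_rel q n (Rel.x_sq i)

theorem Uq.y_mul_self (i : Fin 2) : Uq.y q n i * Uq.y q n i = 0 := by
  simpa [Uq.y, sq] using Uq.mk_rel q n (Rel.y_sq i)

/-- The half powers in γ̄_i γ_i combine to κ_i^{2n} = 1 and leave the other κ; as q_ii = q^n = -1,
the braided commutator is an anticommutator. -/
theorem Uq.x_mul_y_same (hn : 1 < n) (hq : IsPrimitiveRoot q (2 * n)) (i : Fin 2) :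
    Uq.x q n i * Uq.y q n i = 1 - Uq.κ q n (i + 1) - Uq.y q n i * Uq.x q n i := by
  have h := Uq.mk_rel q n (Rel.y_x_same i)
  have hκ : ∀ j, Uq.mk q n (fκ k j) ^ n * Uq.mk q n (fκ k j) ^ n = 1 := by
    intro j
    rw [← pow_add, ← two_mul]
    exact Uq.κ_pow j
  have hγ : Uq.mk q n (fγbar k n i * fγ k n i) = Uq.κ q n (i + 1) := by
    fin_cases i
    · simp only [fγbar, fγ, uMat, map_mul, map_pow, Fin.zero_eta, if_true, zero_add]
      simp [← mul_assoc, hκ, Uq.κ]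
    · simp only [fγbar, fγ, uMat, map_mul, Fin.mk_one, if_true]
      simp [mul_assoc, hκ, Uq.κ]
  rw [map_sub (Uq.mk q n) 1, hγ, map_one] at h
  simp only [uMat, if_true, pow_half_eq_neg_one hn hq, neg_smul, one_smul, sub_neg_eq_add,
    map_add, map_mul] at h
  rw [← h]
  simp [Uq.x, Uq.y]

theorem Uq.x_mul_y_ne (hn : 1 < n) (hq : IsPrimitiveRoot q (2 * n)) (a : Fin 2) :
    Uq.x q n a * Uq.y q n (a + 1) = exchangeFactor q a • (Uq.y q n (a + 1) * Uq.x q n a) := by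
  have h0 : q ≠ 0 := hq.ne_zero (by omega)
  have h := Uq.mk_rel q n (Rel.y_x_ne (a + 1) a (by fin_cases a <;> simp))
  rw [map_sub, map_smul, map_zero, sub_eq_zero, map_mul, map_mul] at h
  change Uq.y q n (a + 1) * Uq.x q n a = _ • (Uq.x q n a * Uq.y q n (a + 1)) at h
  rw [h, smul_smul]
  fin_cases a <;> simp [exchangeFactor, uMat, h0]

theorem add_pow_of_mul_eq_zero {R : Type*} [Ring R] {a b : R} (hab : a * b = 0) (hba : b * a = 0)
    {m : ℕ} (hm : m ≠ 0) : (a + b) ^ m = a ^ m + b ^ m := by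
  obtain ⟨m, rfl⟩ := Nat.exists_eq_succ_of_ne_zero hm
  clear hm
  induction m with
  | zero => simp
  | succ m ih =>
    have h1 : a ^ (m + 1) * b = 0 := by rw [pow_succ, mul_assoc, hab, mul_zero]
    have h2 : b ^ (m + 1) * a = 0 := by rw [pow_succ, mul_assoc, hba, mul_zero]
    rw [pow_succ, ih, pow_succ a (m + 1), pow_succ b (m + 1)]
    simp [add_mul, mul_add, h1, h2]

/-- The products st and ts annihilate each other because s^2 = t^2 = 0, so no mixed terms occur, and
(-q)^N = 1 since N is even. -/
theorem qcommutator_pow (hn : 1 < n) (hq : IsPrimitiveRoot q (2 * n)) {R : Type*} [Ring R]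
    [Algebra k R] {s t : R} (hs : s * s = 0) (ht : t * t = 0) :
    (s * t - q • (t * s)) ^ (2 * n) = (s * t) ^ (2 * n) + (t * s) ^ (2 * n) := by
  rw [sub_eq_add_neg, ← neg_smul, add_pow_of_mul_eq_zero _ _ (by omega), smul_pow, neg_pow,
    (even_two_mul n).neg_one_pow, hq.pow_eq_one, one_mul, one_smul]
  · rw [mul_smul_comm, mul_assoc, ← mul_assoc t t, ht, zero_mul, mul_zero, smul_zero]
  · rw [smul_mul_assoc, mul_assoc, ← mul_assoc s s, hs, zero_mul, mul_zero, smul_zero]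

/-- Two elements with square zero and `(t_1 t_2)^N + (t_2 t_1)^N = 0`. -/
structure IsNilPair (n : ℕ) {R : Type*} [Ring R] (t : Fin 2 → R) : Prop where
  mul_self : ∀ i, t i * t i = 0
  pow_add : (t 0 * t 1) ^ (2 * n) + (t 1 * t 0) ^ (2 * n) = 0

theorem isNilPair_x (hn : 1 < n) (hq : IsPrimitiveRoot q (2 * n)) : IsNilPair n (Uq.x q n) where
  mul_self := Uq.x_mul_self
  pow_add := by
    rw [← qcommutator_pow hn hq (Uq.x_mul_self 0) (Uq.x_mul_self 1)]
    simpa [Uq.x, uMat] using Uq.mk_rel q n Rel.x12_pow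

theorem isNilPair_y (hn : 1 < n) (hq : IsPrimitiveRoot q (2 * n)) : IsNilPair n (Uq.y q n) where
  mul_self := Uq.y_mul_self
  pow_add := by
    rw [← qcommutator_pow hn hq (Uq.y_mul_self 0) (Uq.y_mul_self 1)]
    simpa [Uq.y, uMat] using Uq.mk_rel q n Rel.y12_pow

end Relations

/-! ## Alternating words -/

section Words

theorem altLetter_zero (a : Fin 2) : altLetter a 0 = a := by simp [altLetter]

theorem altLetter_succ (a : Fin 2) (s : ℕ) : altLetter a (s + 1) = altLetter a s + 1 := by
  have h2 : a + 1 + 1 = a := by fin_cases a <;> rfl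
  by_cases h : Even s <;> simp [altLetter, Nat.even_add_one, h, h2]

theorem altLetter_add_one (a : Fin 2) (s : ℕ) : altLetter (a + 1) s = altLetter a s + 1 := by
  unfold altLetter; split_ifs <;> rfl

theorem altLetter_two_mul (a : Fin 2) (r : ℕ) : altLetter a (2 * r) = a := by simp [altLetter]

theorem altLetter_two_mul_add_one (a : Fin 2) (r : ℕ) : altLetter a (2 * r + 1) = a + 1 := by
  rw [altLetter_succ, altLetter_two_mul]

theorem fin_two_add_one_add_one (a : Fin 2) : a + 1 + 1 = a := by fin_cases a <;> rfl

theorem fin_two_eq_or (a b : Fin 2) : b = a ∨ b = a + 1 := by fin_cases a <;> fin_cases b <;> simp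

theorem fin_two_ne (a : Fin 2) : a ≠ a + 1 := by fin_cases a <;> simp

variable {R : Type*} [Ring R] {V : Type*} [AddCommGroup V] [Module R V] {n : ℕ}

/-- The vector reached from `v` after `s` letters of the alternating word starting with `a`. -/
def path (t : Fin 2 → R) (v : V) (a : Fin 2) : ℕ → V
  | 0 => v
  | s + 1 => t (altLetter a s) • path t v a s

/-- The action of a word in the letters `t i` on a vector. -/
def wordAct (t : Fin 2 → R) (l : List (Fin 2)) (v : V) : V := l.foldr (fun i u => t i • u) v

@[simp] theorem wordAct_nil (t : Fin 2 → R) (v : V) : wordAct t [] v = v := rfl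

@[simp] theorem wordAct_cons (t : Fin 2 → R) (i : Fin 2) (l : List (Fin 2)) (v : V) :
    wordAct t (i :: l) v = t i • wordAct t l v := rfl

theorem wordAct_append (t : Fin 2 → R) (l l' : List (Fin 2)) (v : V) :
    wordAct t (l ++ l') v = wordAct t l (wordAct t l' v) := by
  simp [wordAct]

theorem wordAct_add (t : Fin 2 → R) (l : List (Fin 2)) (v v' : V) :
    wordAct t l (v + v') = wordAct t l v + wordAct t l v' := by
  induction l with
  | nil => rfl
  | cons i l ih => simp [ih]

theorem wordAct_mem (t : Fin 2 → R) (l : List (Fin 2)) {P : Submodule R V} {v : V} (h : v ∈ P) :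
    wordAct t l v ∈ P := by
  induction l with
  | nil => exact h
  | cons i l ih => exact P.smul_mem _ ih

variable {t : Fin 2 → R}

theorem smul_path_succ (ht : ∀ i, t i * t i = 0) (v : V) (a i : Fin 2) (s : ℕ) :
    t i • path t v a (s + 1) = path t v a (s + 2) ∨ t i • path t v a (s + 1) = 0 := by
  rcases fin_two_eq_or (altLetter a s) i with rfl | h
  · right
    rw [path, smul_smul, ht, zero_smul]
  · left
    rw [h, ← altLetter_succ]
    rfl

theorem smul_path_altLetter (v : V) (a : Fin 2) (s : ℕ) :
    t (altLetter a s) • path t v a s = path t v a (s + 1) := rfl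

theorem smul_path_altLetter_add_one (ht : ∀ i, t i * t i = 0) (v : V) (a : Fin 2) (s : ℕ) :
    t (altLetter a (s + 1) + 1) • path t v a (s + 1) = 0 := by
  rw [path, altLetter_succ, fin_two_add_one_add_one, smul_smul, ht, zero_smul]

/-- Once one letter has been applied, the next is forced: repeating it gives zero. Positive length
is needed, since at v itself both letters are allowed. -/
theorem wordAct_path (ht : ∀ i, t i * t i = 0) (v : V) (a : Fin 2) (s : ℕ) (l : List (Fin 2)) :
    wordAct t l (path t v a (s + 1)) = path t v a (s + 1 + l.length) ∨
      wordAct t l (path t v a (s + 1)) = 0 := by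
  induction l with
  | nil => exact Or.inl rfl
  | cons i l ih =>
    rcases ih with h | h
    · rw [wordAct_cons, h, List.length_cons]
      have := smul_path_succ ht v a i (s + l.length)
      convert this using 3 <;> ring_nf
    · exact Or.inr (by rw [wordAct_cons, h, smul_zero])

theorem wordAct_eq_path (ht : ∀ i, t i * t i = 0) (v : V) (l : List (Fin 2)) :
    (∃ a, wordAct t l v = path t v a l.length) ∨ wordAct t l v = 0 := by
  rcases List.eq_nil_or_concat l with rfl | ⟨l', i, rfl⟩
  · exact Or.inl ⟨0, rfl⟩
  · have h1 : wordAct t [i] v = path t v i 1 := by simp [path, altLetter_zero]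
    rw [List.concat_eq_append, wordAct_append, h1]
    rcases wordAct_path ht v i 0 l' with h | h
    · exact Or.inl ⟨i, by rw [h, List.length_append, List.length_singleton]; ring_nf⟩
    · exact Or.inr h

theorem path_two_mul (v : V) (a : Fin 2) (r : ℕ) :
    path t v a (2 * r) = (t (a + 1) * t a) ^ r • v := by
  induction r with
  | zero => simp [path]
  | succ r ih =>
    rw [show 2 * (r + 1) = 2 * r + 1 + 1 by ring, path, path, ih, altLetter_two_mul_add_one,
      altLetter_two_mul, pow_succ', mul_smul, mul_smul]

/-- This is where the two branches close up: the root vector relation, applied to v, identifies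
their ends up to sign. -/
theorem path_top (ht : IsNilPair n t) (v : V) (a : Fin 2) :
    path t v (a + 1) (2 * (2 * n)) = -path t v a (2 * (2 * n)) := by
  have h := congrArg (· • v) ht.pow_add
  simp only [add_smul, zero_smul] at h
  rw [path_two_mul, path_two_mul, fin_two_add_one_add_one]
  fin_cases a
  · exact eq_neg_of_add_eq_zero_left h
  · exact eq_neg_of_add_eq_zero_right h

/-- Up to sign the word of length 2N is also the end of the other branch, and the last letter there
is the one now applied, whose square is zero. -/
theorem path_eq_zero (hn : 1 < n) (ht : IsNilPair n t) (v : V) (a : Fin 2) :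
    path t v a (2 * (2 * n) + 1) = 0 := by
  obtain ⟨s, hs⟩ : ∃ s, 2 * (2 * n) = s + 1 := ⟨2 * (2 * n) - 1, by omega⟩
  have h := path_top ht v (a + 1)
  rw [fin_two_add_one_add_one] at h
  rw [path, h, smul_neg, neg_eq_zero, hs, altLetter_succ]
  have := smul_path_altLetter_add_one ht.mul_self v (a + 1) s
  rwa [altLetter_succ, altLetter_add_one, fin_two_add_one_add_one] at this

theorem wordAct_eq_zero (hn : 1 < n) (ht : IsNilPair n t) (v : V) {l : List (Fin 2)}
    (hl : l.length = 2 * (2 * n) + 1) : wordAct t l v = 0 := by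
  rcases wordAct_eq_path ht.mul_self v l with ⟨a, h⟩ | h
  · rw [h, hl, path_eq_zero hn ht]
  · exact h

end Words

/-! ## Highest weight vectors -/

section Modules

set_option linter.unusedSectionVars false

variable {k : Type u} [Field k] {q : k} {n : ℕ}
  {V : Type*} [AddCommGroup V] [Module k V] [Module (Uq q n) V] [IsScalarTower k (Uq q n) V]

theorem Uq.smul_mem_of_stable (W : Submodule k V)
    (hx : ∀ i, ∀ u ∈ W, Uq.x q n i • u ∈ W) (hy : ∀ i, ∀ u ∈ W, Uq.y q n i • u ∈ W)
    (hκ : ∀ i, ∀ u ∈ W, Uq.κ q n i • u ∈ W) (a : Uq q n) {u : V} (hu : u ∈ W) : a • u ∈ W := by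
  obtain ⟨f, rfl⟩ : ∃ f, Uq.mk q n f = a := RingQuot.mkAlgHom_surjective k _ a
  induction f using FreeAlgebra.induction generalizing u with
  | grade0 r =>
    rw [AlgHom.commutes, algebraMap_smul]
    exact W.smul_mem _ hu
  | grade1 g =>
    cases g with
    | x i => exact hx i u hu
    | y i => exact hy i u hu
    | κ i => exact hκ i u hu
  | mul f g hf hg =>
    rw [map_mul, mul_smul]
    exact hf (hg hu)
  | add f g hf hg =>
    rw [map_add, add_smul]
    exact W.add_mem (hf hu) (hg hu)

variable (q n) in
/-- The vector `v` has weight `w`. -/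
def HasWeight (w : Weight n) (v : V) : Prop := ∀ i, Uq.κ q n i • v = q ^ (w i).val • v

variable (q n) in
/-- The vector `v` has weight `w` and is annihilated by `x_1, x_2`. -/
structure IsHighest (w : Weight n) (v : V) : Prop where
  weight : HasWeight q n w v
  x_smul : ∀ i, Uq.x q n i • v = 0

theorem x_smul_y_same (hn : 1 < n) (hq : IsPrimitiveRoot q (2 * n)) (i : Fin 2) (v : V) :
    Uq.x q n i • Uq.y q n i • v =
      v - Uq.κ q n (i + 1) • v - Uq.y q n i • Uq.x q n i • v := by
  rw [smul_smul, Uq.x_mul_y_same hn hq, sub_smul, sub_smul, one_smul, mul_smul]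

theorem x_smul_y_ne (hn : 1 < n) (hq : IsPrimitiveRoot q (2 * n)) (a : Fin 2) (v : V) :
    Uq.x q n a • Uq.y q n (a + 1) • v =
      exchangeFactor q a • Uq.y q n (a + 1) • Uq.x q n a • v := by
  rw [smul_smul, Uq.x_mul_y_ne hn hq, smul_assoc, mul_smul]

theorem HasWeight.smul {w : Weight n} {v : V} (hv : HasWeight q n w v) (c : k) :
    HasWeight q n w (c • v) := fun i => by rw [smul_comm, hv, smul_comm]

theorem HasWeight.sub {w : Weight n} {v v' : V} (hv : HasWeight q n w v)
    (hv' : HasWeight q n w v') : HasWeight q n w (v - v') := fun i => by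
  rw [smul_sub, hv, hv', smul_sub]

theorem HasWeight.y_smul (hn : 1 < n) (hq : IsPrimitiveRoot q (2 * n)) {w : Weight n} {v : V}
    (hv : HasWeight q n w v) (i : Fin 2) :
    HasWeight q n (w - Pi.single i 1) (Uq.y q n i • v) := by
  intro j
  by_cases h : j = i
  · subst h
    rw [smul_smul, Uq.κ_mul_y_same, smul_assoc, mul_smul, hv, Pi.sub_apply, Pi.single_eq_same,
      pow_val_sub_one hn hq, smul_comm (Uq.y q n j), smul_smul, mul_comm]
  · rw [smul_smul, Uq.κ_mul_y_ne h, mul_smul, hv, smul_comm]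
    simp [h]

theorem HasWeight.x_smul (hn : 1 < n) (hq : IsPrimitiveRoot q (2 * n)) {w : Weight n} {v : V}
    (hv : HasWeight q n w v) (i : Fin 2) :
    HasWeight q n (w + Pi.single i 1) (Uq.x q n i • v) := by
  intro j
  by_cases h : j = i
  · subst h
    have h1 : q ^ ((1 : ZMod (2 * n))).val = q := by simpa using pow_val_natCast hq 1
    rw [smul_smul, Uq.κ_mul_x_same, smul_assoc, mul_smul, hv, Pi.add_apply, Pi.single_eq_same,
      pow_val_add hn hq, h1, smul_comm (Uq.x q n j), smul_smul, mul_comm]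
  · rw [smul_smul, Uq.κ_mul_x_ne h, mul_smul, hv, smul_comm]
    simp [h]

theorem altWeight_zero (w : Weight n) (a : Fin 2) : altWeight w a 0 = w := by
  ext c
  simp [altWeight]

theorem altWeight_succ (w : Weight n) (a : Fin 2) (s : ℕ) :
    altWeight w a (s + 1) = altWeight w a s - Pi.single (altLetter a s) 1 := by
  ext c
  rcases Nat.even_or_odd' s with ⟨r, rfl | rfl⟩
  · rw [altLetter_two_mul, Pi.sub_apply]
    rcases fin_two_eq_or a c with rfl | rfl
    · simp only [altWeight, if_true, Pi.single_eq_same]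
      rw [show (2 * r + 1 + 1) / 2 = r + 1 by omega, show (2 * r + 1) / 2 = r by omega]
      push_cast
      ring
    · simp only [altWeight, if_neg (fin_two_ne a).symm, Pi.single_eq_of_ne (fin_two_ne a).symm]
      rw [show (2 * r + 1) / 2 = r by omega, show 2 * r / 2 = r by omega, sub_zero]
  · rw [altLetter_two_mul_add_one, Pi.sub_apply]
    rcases fin_two_eq_or a c with rfl | rfl
    · simp only [altWeight, if_true, Pi.single_eq_of_ne (fin_two_ne c)]
      rw [show (2 * r + 1 + 1 + 1) / 2 = r + 1 by omega, show (2 * r + 1 + 1) / 2 = r + 1 by omega,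
        sub_zero]
    · simp only [altWeight, if_neg (fin_two_ne a).symm, Pi.single_eq_same]
      rw [show (2 * r + 1 + 1) / 2 = r + 1 by omega, show (2 * r + 1) / 2 = r by omega]
      push_cast
      ring

theorem HasWeight.path (hn : 1 < n) (hq : IsPrimitiveRoot q (2 * n)) {w : Weight n} {v : V}
    (hv : HasWeight q n w v) (a : Fin 2) (s : ℕ) :
    HasWeight q n (altWeight w a s) (path (Uq.y q n) v a s) := by
  induction s with
  | zero => rwa [altWeight_zero]
  | succ s ih =>
    rw [altWeight_succ]
    exact ih.y_smul hn hq _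

theorem HasWeight.wordAct_y (hn : 1 < n) (hq : IsPrimitiveRoot q (2 * n)) {w : Weight n} {v : V}
    (hv : HasWeight q n w v) (l : List (Fin 2)) :
    ∃ w' : Weight n, HasWeight q n w' (wordAct (Uq.y q n) l v) := by
  induction l with
  | nil => exact ⟨w, hv⟩
  | cons i l ih => exact ih.imp' _ fun w' h => h.y_smul hn hq i

theorem HasWeight.wordAct_x (hn : 1 < n) (hq : IsPrimitiveRoot q (2 * n)) {w : Weight n} {v : V}
    (hv : HasWeight q n w v) (l : List (Fin 2)) :
    ∃ w' : Weight n, HasWeight q n w' (wordAct (Uq.x q n) l v) := by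
  induction l with
  | nil => exact ⟨w, hv⟩
  | cons i l ih => exact ih.imp' _ fun w' h => h.x_smul hn hq i

variable (k) in
/-- The span of the vectors obtained from `v` by words in the `y_i`. -/
def wordSpan (q : k) (n : ℕ) {V : Type*} [AddCommGroup V] [Module k V] [Module (Uq q n) V] (v : V) :
    Submodule k V :=
  Submodule.span k (Set.range fun l => wordAct (Uq.y q n) l v)

theorem wordAct_mem_wordSpan (l : List (Fin 2)) (v : V) :
    wordAct (Uq.y q n) l v ∈ wordSpan k q n v := Submodule.subset_span ⟨l, rfl⟩

theorem smul_mem_wordSpan_of_forall {v : V} {a : Uq q n}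
    (h : ∀ l, a • wordAct (Uq.y q n) l v ∈ wordSpan k q n v) {u : V}
    (hu : u ∈ wordSpan k q n v) : a • u ∈ wordSpan k q n v := by
  induction hu using Submodule.span_induction with
  | mem u hu =>
    obtain ⟨l, rfl⟩ := hu
    exact h l
  | zero => rw [smul_zero]; exact zero_mem _
  | add u u' _ _ h h' => rw [smul_add]; exact add_mem h h'
  | smul c u _ h => rw [smul_comm]; exact Submodule.smul_mem _ _ h

theorem y_smul_mem_wordSpan (i : Fin 2) {u v : V} (hu : u ∈ wordSpan k q n v) :
    Uq.y q n i • u ∈ wordSpan k q n v :=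
  smul_mem_wordSpan_of_forall (fun l => wordAct_mem_wordSpan (i :: l) v) hu

/-- Moving x_i past the leading letter leaves a shorter word, on which κ is a scalar because words
are weight vectors, plus a term covered by induction. -/
theorem IsHighest.x_smul_wordAct_mem (hn : 1 < n) (hq : IsPrimitiveRoot q (2 * n)) {w : Weight n}
    {v : V} (hv : IsHighest q n w v) (l : List (Fin 2)) (i : Fin 2) :
    Uq.x q n i • wordAct (Uq.y q n) l v ∈ wordSpan k q n v := by
  induction l with
  | nil =>
    rw [wordAct_nil, hv.x_smul]
    exact zero_mem _
  | cons j l ih =>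
    rw [wordAct_cons]
    rcases fin_two_eq_or i j with rfl | rfl
    · obtain ⟨w', h⟩ := hv.weight.wordAct_y hn hq l
      rw [x_smul_y_same hn hq, h]
      exact sub_mem (sub_mem (wordAct_mem_wordSpan _ _)
        (Submodule.smul_mem _ _ (wordAct_mem_wordSpan _ _))) (y_smul_mem_wordSpan _ ih)
    · rw [x_smul_y_ne hn hq]
      exact Submodule.smul_mem _ _ (y_smul_mem_wordSpan _ ih)

theorem IsHighest.smul_mem_wordSpan (hn : 1 < n) (hq : IsPrimitiveRoot q (2 * n)) {w : Weight n}
    {v : V} (hv : IsHighest q n w v) (a : Uq q n) {u : V} (hu : u ∈ wordSpan k q n v) :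
    a • u ∈ wordSpan k q n v := by
  refine Uq.smul_mem_of_stable _ (fun i u hu => ?_) (fun i u hu => y_smul_mem_wordSpan i hu)
    (fun i u hu => ?_) a hu
  · exact smul_mem_wordSpan_of_forall (fun l => hv.x_smul_wordAct_mem hn hq l i) hu
  · refine smul_mem_wordSpan_of_forall (fun l => ?_) hu
    obtain ⟨w', h⟩ := hv.weight.wordAct_y hn hq l
    rw [h]
    exact Submodule.smul_mem _ _ (wordAct_mem_wordSpan _ _)

theorem IsHighest.wordSpan_eq_top (hn : 1 < n) (hq : IsPrimitiveRoot q (2 * n)) {w : Weight n}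
    {v : V} (hv : IsHighest q n w v) (hgen : Submodule.span (Uq q n) {v} = ⊤) :
    wordSpan k q n v = ⊤ := by
  rw [eq_top_iff]
  intro u _
  obtain ⟨a, rfl⟩ := Submodule.mem_span_singleton.mp (hgen ▸ Submodule.mem_top : u ∈ _)
  exact hv.smul_mem_wordSpan hn hq a (wordAct_mem_wordSpan [] v)

variable (q n V) in
/-- The subspace `y_1 V + y_2 V`. -/
def yImage : Submodule k V where
  carrier := {u | ∃ a b : V, u = Uq.y q n 0 • a + Uq.y q n 1 • b}
  add_mem' := by
    rintro _ _ ⟨a, b, rfl⟩ ⟨a', b', rfl⟩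
    exact ⟨a + a', b + b', by rw [smul_add, smul_add]; abel⟩
  zero_mem' := ⟨0, 0, by simp⟩
  smul_mem' := by
    rintro c _ ⟨a, b, rfl⟩
    exact ⟨c • a, c • b, by rw [smul_add, smul_comm c, smul_comm c]⟩

theorem y_smul_mem_yImage (i : Fin 2) (u : V) : Uq.y q n i • u ∈ yImage q n V := by
  fin_cases i
  · exact ⟨u, 0, by simp⟩
  · exact ⟨0, u, by simp⟩

theorem path_succ_mem_yImage (v : V) (a : Fin 2) (s : ℕ) :
    path (Uq.y q n) v a (s + 1) ∈ yImage q n V := y_smul_mem_yImage _ _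

theorem κ_smul_mem_yImage (i : Fin 2) {u : V} (hu : u ∈ yImage q n V) :
    Uq.κ q n i • u ∈ yImage q n V := by
  have key : ∀ j (a : V), Uq.κ q n i • Uq.y q n j • a ∈ yImage q n V := by
    intro j a
    by_cases h : i = j
    · subst h
      rw [smul_smul, Uq.κ_mul_y_same, smul_assoc, mul_smul]
      exact Submodule.smul_mem _ _ (y_smul_mem_yImage _ _)
    · rw [smul_smul, Uq.κ_mul_y_ne h, mul_smul]
      exact y_smul_mem_yImage _ _
  obtain ⟨a, b, rfl⟩ := hu
  rw [smul_add]
  exact add_mem (key _ _) (key _ _)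

/-- Nakayama's lemma for the nilpotent action of the `y_i`. -/
theorem eq_top_of_add_yImage (hn : 1 < n) (hq : IsPrimitiveRoot q (2 * n))
    (P : Submodule (Uq q n) V) (h : ∀ u : V, ∃ p ∈ P, ∃ y ∈ yImage q n V, u = p + y) : P = ⊤ := by
  -- Descending induction on word length: d counts down from length 2N + 1, where all words vanish,
  -- to the empty word, which gives the claim.
  have key : ∀ d ≤ 2 * (2 * n) + 1, ∀ l : List (Fin 2), l.length = 2 * (2 * n) + 1 - d →
      ∀ u : V, wordAct (Uq.y q n) l u ∈ P := by
    intro d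
    induction d with
    | zero =>
      intro _ l hl u
      rw [wordAct_eq_zero hn (isNilPair_y hn hq) u (by simpa using hl)]
      exact P.zero_mem
    | succ d ih =>
      intro hd l hl u
      obtain ⟨p, hp, _, ⟨a, b, rfl⟩, rfl⟩ := h u
      have h1 : ∀ (i : Fin 2) (a : V), wordAct (Uq.y q n) l (Uq.y q n i • a) ∈ P := by
        intro i a
        have := ih (by omega) (l ++ [i]) (by simp; omega) a
        rwa [wordAct_append] at this
      rw [wordAct_add, wordAct_add]
      exact P.add_mem (wordAct_mem _ _ hp) (P.add_mem (h1 0 a) (h1 1 b))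
  rw [eq_top_iff]
  intro u _
  exact key _ le_rfl [] (by simp) u

/-- The empty word is the only one without a leading y, so modulo y_1 V + y_2 V only multiples of v
remain. -/
theorem IsHighest.exists_eq_smul_add (hn : 1 < n) (hq : IsPrimitiveRoot q (2 * n)) {w : Weight n}
    {v : V} (hv : IsHighest q n w v) {u : V} (hu : u ∈ Submodule.span (Uq q n) {v}) :
    ∃ c : k, ∃ y ∈ yImage q n V, u = c • v + y := by
  obtain ⟨a, rfl⟩ := Submodule.mem_span_singleton.mp hu
  have h : a • v ∈ wordSpan k q n v :=
    hv.smul_mem_wordSpan hn hq a (wordAct_mem_wordSpan [] v)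
  generalize a • v = u at h
  induction h using Submodule.span_induction with
  | mem u hu =>
    obtain ⟨l, rfl⟩ := hu
    cases l with
    | nil => exact ⟨1, 0, zero_mem _, by simp⟩
    | cons i l => exact ⟨0, _, y_smul_mem_yImage i (wordAct (Uq.y q n) l v), by simp⟩
  | zero => exact ⟨0, 0, zero_mem _, by simp⟩
  | add u u' _ _ h h' =>
    obtain ⟨c, y, hy, rfl⟩ := h
    obtain ⟨c', y', hy', rfl⟩ := h'
    exact ⟨c + c', y + y', add_mem hy hy', by rw [add_smul]; abel⟩
  | smul d u _ h =>
    obtain ⟨c, y, hy, rfl⟩ := h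
    exact ⟨d * c, d • y, Submodule.smul_mem _ _ hy, by rw [smul_add, smul_smul]⟩

/-- Otherwise y_1 V + y_2 V would be all of V, and Nakayama applied to the zero submodule would give
V = 0. -/
theorem IsHighest.notMem_yImage (hn : 1 < n) (hq : IsPrimitiveRoot q (2 * n)) {w : Weight n}
    {v : V} (hv : IsHighest q n w v) (hgen : Submodule.span (Uq q n) {v} = ⊤) (h0 : v ≠ 0) :
    v ∉ yImage q n V := by
  intro hmem
  have : (⊥ : Submodule (Uq q n) V) = ⊤ := by
    refine eq_top_of_add_yImage hn hq _ fun u => ⟨0, zero_mem _, u, ?_, by simp⟩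
    obtain ⟨c, y, hy, rfl⟩ := hv.exists_eq_smul_add (u := u) hn hq (hgen ▸ Submodule.mem_top)
    exact add_mem (Submodule.smul_mem _ _ hmem) hy
  exact h0 ((Submodule.mem_bot (Uq q n)).mp (this ▸ Submodule.mem_top))

/-- In a simple module the only highest weight vector in `y_1 V + y_2 V` is zero. -/
theorem IsHighest.eq_zero_of_mem_yImage (hn : 1 < n) (hq : IsPrimitiveRoot q (2 * n))
    [IsSimpleModule (Uq q n) V] {w : Weight n} {v : V} (hv : IsHighest q n w v)
    (h : v ∈ yImage q n V) : v = 0 := by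
  by_contra h0
  exact hv.notMem_yImage hn hq (IsSimpleModule.span_singleton_eq_top _ h0) h0 h

end Modules

/-! ## Standard modules and their heads -/

section Standard

variable {k : Type u} [Field k] {q : k} {n : ℕ}

theorem borelToUq_smul {V : Type*} [AddCommGroup V] [Module k V] [Module (Uq q n) V]
    [IsScalarTower k (Uq q n) V] (hn : 1 < n) (hq : IsPrimitiveRoot q (2 * n)) {w : Weight n}
    {v : V} (hv : IsHighest q n w v) (b : Borel q n) :
    borelToUq q n b • v = borelChar hn hq w b • v := by
  obtain ⟨f, rfl⟩ := RingQuot.mkAlgHom_surjective k (BorelRel q n) b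
  have h1 : borelToUq q n (RingQuot.mkAlgHom k (BorelRel q n) f) =
      FreeAlgebra.lift k (borelGenToUq q n) f := RingQuot.liftAlgHom_mkAlgHom_apply k _ _ f
  have h2 : borelChar hn hq w (RingQuot.mkAlgHom k (BorelRel q n) f) =
      FreeAlgebra.lift k (borelCharGen q w) f := RingQuot.liftAlgHom_mkAlgHom_apply k _ _ f
  rw [h1, h2]
  clear h1 h2
  induction f using FreeAlgebra.induction with
  | grade0 r => simp [algebraMap_smul]
  | grade1 g =>
    rw [FreeAlgebra.lift_ι_apply, FreeAlgebra.lift_ι_apply]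
    cases g with
    | x i => simpa [borelGenToUq, borelCharGen] using hv.x_smul i
    | κ i => exact hv.weight i
  | mul f g hf hg => rw [map_mul, map_mul, mul_smul, hg, smul_comm, hf, smul_smul, mul_comm]
  | add f g hf hg => rw [map_add, map_add, add_smul, add_smul, hf, hg]

/-- The canonical generator of `M(w)`. -/
def stdVec (hn : 1 < n) (hq : IsPrimitiveRoot q (2 * n)) (w : Weight n) : StdModule hn hq w :=
  Submodule.Quotient.mk ((1 : Uq q n) ⊗ₜ[k] (1 : k))

theorem stdVec_generates (hn : 1 < n) (hq : IsPrimitiveRoot q (2 * n)) (w : Weight n) :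
    Submodule.span (Uq q n) {stdVec hn hq w} = ⊤ := by
  rw [eq_top_iff]
  intro u _
  obtain ⟨t, rfl⟩ := Submodule.Quotient.mk_surjective _ u
  induction t with
  | zero => exact zero_mem _
  | add t t' h h' => exact add_mem (h trivial) (h' trivial)
  | tmul a c =>
    refine Submodule.mem_span_singleton.mpr ⟨c • a, ?_⟩
    rw [stdVec, ← Submodule.Quotient.mk_smul]
    congr 1
    rw [TensorProduct.smul_tmul', smul_eq_mul, mul_one, TensorProduct.smul_tmul, smul_eq_mul,
      mul_one]

theorem stdVec_isHighest (hn : 1 < n) (hq : IsPrimitiveRoot q (2 * n)) (w : Weight n) :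
    IsHighest q n w (stdVec hn hq w) := by
  have key : ∀ b : Borel q n, borelToUq q n b • stdVec hn hq w =
      borelChar hn hq w b • stdVec hn hq w := by
    intro b
    have h : (borelToUq q n b) ⊗ₜ[k] (1 : k) - (1 : Uq q n) ⊗ₜ[k] (borelRep hn hq w b 1) ∈
        inducedRel (borelToUq q n) (borelRep hn hq w) :=
      Submodule.subset_span ⟨1, b, 1, by rw [one_mul]⟩
    rw [← Submodule.Quotient.eq] at h
    rw [stdVec, ← Submodule.Quotient.mk_smul, ← Submodule.Quotient.mk_smul,
      TensorProduct.smul_tmul', smul_eq_mul, mul_one, h]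
    congr 1
    rw [TensorProduct.smul_tmul', TensorProduct.smul_tmul]
    rfl
  constructor
  · intro i
    have h := key (RingQuot.mkAlgHom k (BorelRel q n) (bκ k i))
    have h1 : borelToUq q n (RingQuot.mkAlgHom k (BorelRel q n) (bκ k i)) = Uq.κ q n i :=
      (RingQuot.liftAlgHom_mkAlgHom_apply k _ _ (bκ k i)).trans (FreeAlgebra.lift_ι_apply _ _)
    have h2 : borelChar hn hq w (RingQuot.mkAlgHom k (BorelRel q n) (bκ k i)) = q ^ (w i).val :=
      (RingQuot.liftAlgHom_mkAlgHom_apply k _ _ (bκ k i)).trans (FreeAlgebra.lift_ι_apply _ _)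
    rwa [h1, h2] at h
  · intro i
    have h := key (RingQuot.mkAlgHom k (BorelRel q n) (bx k i))
    have h1 : borelToUq q n (RingQuot.mkAlgHom k (BorelRel q n) (bx k i)) = Uq.x q n i :=
      (RingQuot.liftAlgHom_mkAlgHom_apply k _ _ (bx k i)).trans (FreeAlgebra.lift_ι_apply _ _)
    have h2 : borelChar hn hq w (RingQuot.mkAlgHom k (BorelRel q n) (bx k i)) = 0 :=
      (RingQuot.liftAlgHom_mkAlgHom_apply k _ _ (bx k i)).trans (FreeAlgebra.lift_ι_apply _ _)
    rwa [h1, h2, zero_smul] at h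

/-- The universal property of induction, in the form of Frobenius reciprocity for a one-dimensional
module of the Borel part. -/
theorem exists_stdModule_hom {V : Type*} [AddCommGroup V] [Module k V] [Module (Uq q n) V]
    [IsScalarTower k (Uq q n) V] (hn : 1 < n) (hq : IsPrimitiveRoot q (2 * n)) {w : Weight n}
    {v : V} (hv : IsHighest q n w v) :
    ∃ f : StdModule hn hq w →ₗ[Uq q n] V, f (stdVec hn hq w) = v := by
  let g : Uq q n ⊗[k] k →ₗ[Uq q n] V :=
    (LinearMap.toSpanSingleton (Uq q n) V v).comp
      (TensorProduct.AlgebraTensorModule.rid k (Uq q n) (Uq q n)).toLinearMap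
  have hg : ∀ (a : Uq q n) (c : k), g (a ⊗ₜ[k] c) = c • a • v := by
    intro a c
    simp [g]
  refine ⟨Submodule.liftQ _ g ?_, ?_⟩
  · rw [inducedRel, Submodule.span_le]
    rintro _ ⟨a, b, c, rfl⟩
    rw [SetLike.mem_coe, LinearMap.mem_ker, map_sub, hg, hg, mul_smul, borelToUq_smul hn hq hv,
      sub_eq_zero, smul_comm a, smul_smul]
    congr 1
    exact mul_comm _ _
  · exact (hg 1 1).trans (by simp)

theorem exists_stdModule_hom_surjective {V : Type*} [AddCommGroup V] [Module k V]
    [Module (Uq q n) V] [IsScalarTower k (Uq q n) V] (hn : 1 < n) (hq : IsPrimitiveRoot q (2 * n))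
    {w : Weight n} {v : V} (hv : IsHighest q n w v)
    (hgen : Submodule.span (Uq q n) {v} = ⊤) :
    ∃ f : StdModule hn hq w →ₗ[Uq q n] V, Function.Surjective f ∧ f (stdVec hn hq w) = v := by
  obtain ⟨f, hf⟩ := exists_stdModule_hom hn hq hv
  refine ⟨f, ?_, hf⟩
  rw [← LinearMap.range_eq_top, eq_top_iff, ← hgen, Submodule.span_le, Set.singleton_subset_iff]
  exact ⟨_, hf⟩

/-- In a module generated by a nonzero highest weight vector, the sum of the proper submodules is
proper. -/
theorem sumProper_ne_top {V : Type u} [AddCommGroup V] [Module k V]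
    [Module (Uq q n) V] [IsScalarTower k (Uq q n) V] (hn : 1 < n) (hq : IsPrimitiveRoot q (2 * n))
    {w : Weight n} {v : V} (hv : IsHighest q n w v)
    (hgen : Submodule.span (Uq q n) {v} = ⊤) (h0 : v ≠ 0) : sumProper (Uq q n) V ≠ ⊤ := by
  -- The largest submodule contained in y_1 V + y_2 V. It turns out to contain every proper
  -- submodule, and it misses v.
  let J : Submodule (Uq q n) V :=
    { carrier := {m | ∀ a : Uq q n, a • m ∈ yImage q n V}
      add_mem' := fun h h' a => by
        rw [smul_add]
        exact add_mem (h a) (h' a)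
      zero_mem' := fun a => by
        rw [smul_zero]
        exact zero_mem _
      smul_mem' := fun b m h a => by
        rw [smul_smul]
        exact h _ }
  have hJ : sumProper (Uq q n) V ≤ J := by
    refine sSup_le fun P hP m hm a => ?_
    obtain ⟨c, y, hy, h⟩ := hv.exists_eq_smul_add (u := a • m) hn hq (hgen ▸ Submodule.mem_top)
    by_cases hc : c = 0
    · rw [h, hc, zero_smul, zero_add]
      exact hy
    -- With c ≠ 0 the submodule P contains v modulo y_1 V + y_2 V, hence everything modulo it, and
    -- Nakayama gives P = V.
    · refine absurd (eq_top_of_add_yImage hn hq P fun u => ?_) hP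
      obtain ⟨d, y', hy', hu⟩ := hv.exists_eq_smul_add (u := u) hn hq (hgen ▸ Submodule.mem_top)
      refine ⟨(d * c⁻¹) • a • m, ?_, y' - (d * c⁻¹) • y,
        sub_mem hy' (Submodule.smul_mem _ _ hy), ?_⟩
      · rw [← smul_assoc]
        exact P.smul_mem _ hm
      · rw [hu, h, smul_add, smul_smul, mul_assoc, inv_mul_cancel₀ hc, mul_one]
        abel
  intro h
  refine hv.notMem_yImage hn hq hgen h0 ?_
  have : v ∈ J := hJ (h ▸ Submodule.mem_top)
  simpa using this 1

theorem isCoatom_sumProper {R : Type*} [Ring R] {V : Type*} [AddCommGroup V] [Module R V]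
    (h : sSup {P : Submodule R V | P ≠ ⊤} ≠ ⊤) : IsCoatom (sSup {P : Submodule R V | P ≠ ⊤}) := by
  refine ⟨h, fun P hP => ?_⟩
  by_contra hne
  exact hP.not_ge (le_sSup hne)

theorem sumProper_stdModule_isCoatom (hn : 1 < n) (hq : IsPrimitiveRoot q (2 * n)) (w : Weight n)
    (h0 : stdVec hn hq w ≠ 0) : IsCoatom (sumProper (Uq q n) (StdModule hn hq w)) :=
  isCoatom_sumProper (sumProper_ne_top hn hq (stdVec_isHighest hn hq w)
    (stdVec_generates hn hq w) h0)

/-- A simple module with a highest weight vector of weight `w` is isomorphic to `L(w)`. -/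
theorem nonempty_linearEquiv_simpleHead {V : Type*} [AddCommGroup V] [Module k V]
    [Module (Uq q n) V] [IsScalarTower k (Uq q n) V] (hn : 1 < n) (hq : IsPrimitiveRoot q (2 * n))
    [IsSimpleModule (Uq q n) V] {w : Weight n} {v : V} (hv : IsHighest q n w v) (h0 : v ≠ 0) :
    Nonempty (V ≃ₗ[Uq q n] SimpleHead hn hq w) := by
  obtain ⟨f, hf, hfv⟩ := exists_stdModule_hom_surjective hn hq hv
    (IsSimpleModule.span_singleton_eq_top _ h0)
  have hM : stdVec hn hq w ≠ 0 := by
    intro h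
    rw [h, map_zero] at hfv
    exact h0 hfv.symm
  have hc := sumProper_stdModule_isCoatom hn hq w hM
  have hne : LinearMap.ker f ≠ ⊤ := by
    intro h
    refine h0 ?_
    rw [← hfv]
    exact LinearMap.mem_ker.mp (h ▸ Submodule.mem_top)
  have hle : LinearMap.ker f ≤ sumProper (Uq q n) (StdModule hn hq w) := le_sSup hne
  -- The kernel is maximal because V is simple, and it lies in the sum of the proper submodules,
  -- which is itself proper; so the two agree.
  have hco : IsCoatom (LinearMap.ker f) := by
    rw [← isSimpleModule_iff_isCoatom]
    exact IsSimpleModule.congr (f.quotKerEquivOfSurjective hf)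
  have heq : LinearMap.ker f = sumProper (Uq q n) (StdModule hn hq w) :=
    (hco.le_iff.mp hle).resolve_left hc.1 |>.symm
  exact ⟨(f.quotKerEquivOfSurjective hf).symm.trans (Submodule.quotEquivOfEq _ _ heq)⟩

/-- The generator of `L(w)`. -/
def headVec (hn : 1 < n) (hq : IsPrimitiveRoot q (2 * n)) (w : Weight n) : SimpleHead hn hq w :=
  Submodule.mkQ _ (stdVec hn hq w)

theorem headVec_generates (hn : 1 < n) (hq : IsPrimitiveRoot q (2 * n)) (w : Weight n) :
    Submodule.span (Uq q n) {headVec hn hq w} = ⊤ := by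
  have h := congrArg (Submodule.map (sumProper (Uq q n) (StdModule hn hq w)).mkQ)
    (stdVec_generates hn hq w)
  rwa [Submodule.map_span, Set.image_singleton, Submodule.map_top, Submodule.range_mkQ] at h

theorem headVec_isHighest (hn : 1 < n) (hq : IsPrimitiveRoot q (2 * n)) (w : Weight n) :
    IsHighest q n w (headVec hn hq w) where
  weight i := by
    rw [headVec, ← map_smul, (stdVec_isHighest hn hq w).weight]
    rfl
  x_smul i := by
    rw [headVec, ← map_smul, (stdVec_isHighest hn hq w).x_smul, map_zero]

/-- The weight of the generator is determined by the action of the `κ_i` modulo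
`y_1 L + y_2 L`. -/
theorem eq_of_linearEquiv {V V' : Type*} [AddCommGroup V] [Module k V] [Module (Uq q n) V]
    [IsScalarTower k (Uq q n) V] [AddCommGroup V'] [Module k V'] [Module (Uq q n) V']
    [IsScalarTower k (Uq q n) V'] (hn : 1 < n) (hq : IsPrimitiveRoot q (2 * n))
    {w w' : Weight n} {v : V} {v' : V'} (hv : IsHighest q n w v) (hv' : IsHighest q n w' v')
    (hgen : Submodule.span (Uq q n) {v} = ⊤) (hgen' : Submodule.span (Uq q n) {v'} = ⊤)
    (h0 : v ≠ 0) (h0' : v' ≠ 0) (φ : V ≃ₗ[Uq q n] V') : w = w' := by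
  obtain ⟨c, y, hy, h⟩ := hv'.exists_eq_smul_add (u := φ v) hn hq (hgen' ▸ Submodule.mem_top)
  -- If φ v were in y_1 V' + y_2 V', pulling back along φ would put v in y_1 V + y_2 V.
  have hc : c ≠ 0 := by
    rintro rfl
    refine hv.notMem_yImage hn hq hgen h0 ?_
    obtain ⟨a, b, rfl⟩ := hy
    refine ⟨φ.symm a, φ.symm b, ?_⟩
    rw [← map_smul, ← map_smul, ← map_add, LinearEquiv.eq_symm_apply, h]
    simp
  ext i
  by_contra hne
  have h1 : Uq.κ q n i • φ v = q ^ (w i).val • φ v := by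
    rw [← map_smul, hv.weight, ← algebraMap_smul (Uq q n), map_smul, algebraMap_smul]
  rw [h, smul_add, smul_comm, hv'.weight, smul_add] at h1
  -- Computing κ_i on φ v = c v' + y in two ways: distinct weights would force a nonzero multiple of
  -- v' into y_1 V' + y_2 V'.
  have h2 : (c * (q ^ (w' i).val - q ^ (w i).val)) • v' =
      q ^ (w i).val • y - Uq.κ q n i • y := by
    rw [mul_sub, sub_smul, mul_smul, mul_smul, smul_comm c (q ^ (w i).val), sub_eq_sub_iff_add_eq_add,
      h1, add_comm]
  have h3 : c * (q ^ (w' i).val - q ^ (w i).val) ≠ 0 := by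
    refine mul_ne_zero hc (sub_ne_zero.mpr fun h => hne ?_)
    exact (pow_val_injective hn hq h).symm
  refine hv'.notMem_yImage hn hq hgen' h0' ?_
  rw [← inv_smul_smul₀ h3 v', h2]
  exact Submodule.smul_mem _ _ (sub_mem (Submodule.smul_mem _ _ hy) (κ_smul_mem_yImage i hy))

end Standard

/-! ## Highest weight vectors in simple modules -/

section Existence

variable {k : Type u} [Field k] {q : k} {n : ℕ}

/-- Either v is an eigenvector for ζ, or (T - ζ)v is a nonzero vector killed by one factor fewer. No
finite dimension is needed. The stable subspace P allows the search to run inside an eigenspace of a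
commuting operator. -/
theorem exists_eigenvector_of_prod {W : Type*} [AddCommGroup W] [Module k W]
    (T : Module.End k W) (s : Finset k) (P : Submodule k W) (hP : ∀ u ∈ P, T u ∈ P) {v : W}
    (hv : v ∈ P) (h0 : v ≠ 0)
    (h : Polynomial.aeval T (∏ ζ ∈ s, (Polynomial.X - Polynomial.C ζ)) v = 0) :
    ∃ ζ ∈ s, ∃ u ∈ P, u ≠ 0 ∧ T u = ζ • u := by
  classical
  induction s using Finset.induction generalizing v with
  | empty => simp [h0] at h
  | insert ζ s hζ ih =>
    by_cases h1 : T v = ζ • v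
    · exact ⟨ζ, Finset.mem_insert_self _ _, v, hv, h0, h1⟩
    · rw [Finset.prod_insert hζ, mul_comm, map_mul, Module.End.mul_apply] at h
      have h2 : Polynomial.aeval T (Polynomial.X - Polynomial.C ζ) v = T v - ζ • v := by
        simp [Module.algebraMap_end_apply]
      rw [h2] at h
      obtain ⟨ξ, hξ, u, hu⟩ := ih (sub_mem (hP v hv) (P.smul_mem _ hv)) (sub_ne_zero.mpr h1) h
      exact ⟨ξ, Finset.mem_insert_of_mem hξ, u, hu⟩

theorem exists_eigenvector_of_pow_eq_one (hn : 1 < n) (hq : IsPrimitiveRoot q (2 * n))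
    {W : Type*} [AddCommGroup W] [Module k W]
    (T : Module.End k W) (hT : T ^ (2 * n) = 1) (P : Submodule k W) (hP : ∀ u ∈ P, T u ∈ P) {v : W}
    (hv : v ∈ P) (h0 : v ≠ 0) :
    ∃ a : ZMod (2 * n), ∃ u ∈ P, u ≠ 0 ∧ T u = q ^ a.val • u := by
  have h : Polynomial.aeval T
      (∏ ζ ∈ Polynomial.nthRootsFinset (2 * n) (1 : k), (Polynomial.X - Polynomial.C ζ)) v = 0 := by
    rw [← Polynomial.X_pow_sub_one_eq_prod (by omega) hq]
    simp [hT]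
  obtain ⟨ζ, hζ, u, hu, hu0, hTu⟩ := exists_eigenvector_of_prod T _ P hP hv h0 h
  have : NeZero (2 * n) := ⟨by omega⟩
  rw [Polynomial.mem_nthRootsFinset (by omega)] at hζ
  obtain ⟨i, _, rfl⟩ := hq.eq_pow_of_pow_eq_one hζ
  exact ⟨i, u, hu, hu0, by rw [hTu, pow_val_natCast hq]⟩

theorem exists_hasWeight (hn : 1 < n) (hq : IsPrimitiveRoot q (2 * n)) {V : Type*}
    [AddCommGroup V] [Module k V] [Module (Uq q n) V] [IsScalarTower k (Uq q n) V] {v : V}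
    (h0 : v ≠ 0) : ∃ (w : Weight n) (u : V), u ≠ 0 ∧ HasWeight q n w u := by
  let T : Fin 2 → Module.End k V := fun i => Algebra.lsmul k k V (Uq.κ q n i)
  have hT : ∀ i, T i ^ (2 * n) = 1 := fun i => by
    rw [← map_pow, Uq.κ_pow, map_one]
  have hTa : ∀ i u, T i u = Uq.κ q n i • u := fun _ _ => rfl
  obtain ⟨a, u, -, hu0, hu⟩ := exists_eigenvector_of_pow_eq_one hn hq (T 0) (hT 0) ⊤
    (fun _ _ => trivial) (Submodule.mem_top (x := v)) h0
  -- The eigenspace of κ_1 is stable under κ_2, so an eigenvector of κ_2 found in it is a common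
  -- one.
  obtain ⟨b, u', hu', hu0', hub⟩ := exists_eigenvector_of_pow_eq_one hn hq (T 1) (hT 1)
    (Module.End.eigenspace (T 0) (q ^ a.val))
    (fun u hu => by
      rw [Module.End.mem_eigenspace_iff] at hu ⊢
      rw [hTa, hTa, smul_smul, Uq.κ_comm, mul_smul, ← hTa 0, hu, smul_comm])
    (Module.End.mem_eigenspace_iff.mpr hu) hu0
  refine ⟨![a, b], u', hu0', fun i => ?_⟩
  fin_cases i
  · exact Module.End.mem_eigenspace_iff.mp hu'
  · exact hub

/-- Words in the x_i keep a weight vector a weight vector. If no nonzero one were annihilated by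
both x_i, nonzero words of every length would exist, but all words of length 2N + 1 vanish. -/
theorem exists_isHighest (hn : 1 < n) (hq : IsPrimitiveRoot q (2 * n)) {V : Type*}
    [AddCommGroup V] [Module k V] [Module (Uq q n) V] [IsScalarTower k (Uq q n) V] {v : V}
    (h0 : v ≠ 0) : ∃ (w : Weight n) (u : V), u ≠ 0 ∧ IsHighest q n w u := by
  obtain ⟨w, u, hu0, hu⟩ := exists_hasWeight hn hq h0
  by_contra hcon
  push Not at hcon
  have key : ∀ d, ∃ l : List (Fin 2), l.length = d ∧ wordAct (Uq.x q n) l u ≠ 0 := by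
    intro d
    induction d with
    | zero => exact ⟨[], rfl, hu0⟩
    | succ d ih =>
      obtain ⟨l, hl, hne⟩ := ih
      obtain ⟨w', hw'⟩ := hu.wordAct_x hn hq l
      by_contra hall
      push Not at hall
      exact hcon w' _ hne ⟨hw', fun i => hall (i :: l) (by simp [hl])⟩
  obtain ⟨l, hl, hne⟩ := key (2 * (2 * n) + 1)
  exact hne (wordAct_eq_zero hn (isNilPair_x hn hq) u hl)

theorem exists_linearEquiv_simpleHead (hn : 1 < n) (hq : IsPrimitiveRoot q (2 * n)) (V : Type v)
    [AddCommGroup V] [Module (Uq q n) V] (hV : IsSimpleModule (Uq q n) V) :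
    ∃ w : Weight n, Nonempty (V ≃ₗ[Uq q n] SimpleHead hn hq w) := by
  -- Here V comes only with its action of the algebra; scalars act through the structure map.
  let _ : Module k V := Module.compHom V (algebraMap k (Uq q n))
  have : IsScalarTower k (Uq q n) V := ⟨fun c a u => by
    rw [Algebra.smul_def, mul_smul]
    rfl⟩
  have : Nontrivial V := IsSimpleModule.nontrivial (Uq q n) V
  obtain ⟨v, h0⟩ := exists_ne (0 : V)
  obtain ⟨w, u, hu0, hu⟩ := exists_isHighest hn hq h0
  exact ⟨w, nonempty_linearEquiv_simpleHead hn hq hu hu0⟩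

end Existence

/-! ## A model of the standard modules

The alternating words `a_s` and `b_s` are extended to all `s : ℤ`; the components `0, 1, 2, 3` of a
function hold the coefficients of `a_{2r}`, `a_{2r+1}`, `b_{2r}`, `b_{2r+1}`. -/

section Model

variable {k : Type u} [Field k]

/-- The space of functions carrying the model. -/
abbrev ModelSpace (k : Type u) : Type u := Fin 4 → ℤ → k

/-- The powers of `q⁻¹`. -/
def negPow (q : k) (r : ℤ) : k := q ^ (-r)

/-- The operator of `x_1`. -/
def modelX0 (q B : k) : Module.End k (ModelSpace k) where
  toFun f := ![fun r => (1 - B * negPow q r) * f 1 r, 0,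
    fun r => (-1) ^ r * negPow q r * (1 - B) * f 1 r,
    fun r => (-1) ^ r * negPow q (r + 1) * (1 - B) * f 0 (r + 1) +
      (1 - B * negPow q (r + 1)) * f 2 (r + 1)]
  map_add' f g := by
    ext c r
    fin_cases c <;> simp <;> ring
  map_smul' c f := by
    ext i r
    fin_cases i <;> simp <;> ring

/-- The operator of `x_2`. -/
def modelX1 (q A : k) : Module.End k (ModelSpace k) where
  toFun f := ![fun r => (-1) ^ r * (1 - A) * f 3 r,
    fun r => (1 - A * negPow q (r + 1)) * f 0 (r + 1) + (-1) ^ r * (1 - A) * f 2 (r + 1),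
    fun r => (1 - A * negPow q r) * f 3 r, 0]
  map_add' f g := by
    ext c r
    fin_cases c <;> simp <;> ring
  map_smul' c f := by
    ext i r
    fin_cases i <;> simp <;> ring

variable (k) in
/-- The operator of `y_1`. -/
def modelY0 : Module.End k (ModelSpace k) where
  toFun f := ![0, f 0, fun r => f 3 (r - 1), 0]
  map_add' f g := by
    ext c r
    fin_cases c <;> simp
  map_smul' c f := by
    ext i r
    fin_cases i <;> simp

variable (k) in
/-- The operator of `y_2`. -/
def modelY1 : Module.End k (ModelSpace k) where
  toFun f := ![fun r => f 1 (r - 1), 0, 0, f 2]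
  map_add' f g := by
    ext c r
    fin_cases c <;> simp
  map_smul' c f := by
    ext i r
    fin_cases i <;> simp

/-- The operator multiplying by a function. -/
def modelDiag (d : Fin 4 → ℤ → k) : Module.End k (ModelSpace k) where
  toFun f := d * f
  map_add' _ _ := mul_add _ _ _
  map_smul' _ _ := mul_smul_comm _ _ _

/-- The eigenvalues of `κ_1`. -/
def modelK0 (q A : k) : Fin 4 → ℤ → k :=
  ![fun r => A * negPow q r, fun r => A * negPow q (r + 1), fun r => A * negPow q r,
    fun r => A * negPow q r]

/-- The eigenvalues of `κ_2`. -/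
def modelK1 (q B : k) : Fin 4 → ℤ → k :=
  ![fun r => B * negPow q r, fun r => B * negPow q r, fun r => B * negPow q r,
    fun r => B * negPow q (r + 1)]

/-- The operators of the generators. -/
def modelGen (q A B : k) : Gen → Module.End k (ModelSpace k)
  | Gen.x i => if i = 0 then modelX0 q B else modelX1 q A
  | Gen.y i => if i = 0 then modelY0 k else modelY1 k
  | Gen.κ i => if i = 0 then modelDiag (modelK0 q A) else modelDiag (modelK1 q B)

/-- The action of the free algebra. -/
def modelRep (q A B : k) : FreeAlgebra k Gen →ₐ[k] Module.End k (ModelSpace k) :=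
  FreeAlgebra.lift k (modelGen q A B)

/-- The shift by `m` steps. -/
def modelShift (k : Type u) [Field k] (m : ℤ) : Module.End k (ModelSpace k) where
  toFun f c r := f c (r + m)
  map_add' _ _ := rfl
  map_smul' _ _ := rfl

theorem modelShift_apply (m : ℤ) (f : ModelSpace k) (c : Fin 4) (r : ℤ) :
    modelShift k m f c r = f c (r + m) := rfl

theorem negPow_add_one {q : k} (hq : q ≠ 0) (r : ℤ) : negPow q (r + 1) = negPow q r * q⁻¹ := by
  rw [negPow, negPow, neg_add, zpow_add₀ hq, zpow_neg_one]

theorem negPow_sub_one {q : k} (hq : q ≠ 0) (r : ℤ) : negPow q (r - 1) = negPow q r * q := by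
  rw [negPow, negPow, neg_sub, sub_eq_neg_add, zpow_add₀ hq, zpow_one]

theorem neg_one_zpow_mul_self (r : ℤ) : (-1 : k) ^ r * (-1) ^ r = 1 := by
  rw [← mul_zpow]
  simp

theorem neg_one_zpow_add_one (r : ℤ) : (-1 : k) ^ (r + 1) = -(-1) ^ r := by
  rw [zpow_add₀ (by simp)]
  simp

theorem neg_one_zpow_sub_one (r : ℤ) : (-1 : k) ^ (r - 1) = -(-1) ^ r := by
  rw [← sub_add_cancel r 1, neg_one_zpow_add_one, sub_add_cancel, neg_neg]

theorem modelDiag_pow (d : Fin 4 → ℤ → k) (m : ℕ) :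
    modelDiag d ^ m = modelDiag (d ^ m) := by
  induction m with
  | zero => ext f; simp [modelDiag]
  | succ m ih =>
    rw [pow_succ, ih]
    refine LinearMap.ext fun f => ?_
    change d ^ m * (d * f) = d ^ (m + 1) * f
    rw [pow_succ, mul_assoc]

theorem modelX0_apply (q B : k) (f : ModelSpace k) :
    modelX0 q B f = ![fun r => (1 - B * negPow q r) * f 1 r, 0,
    fun r => (-1) ^ r * negPow q r * (1 - B) * f 1 r,
    fun r => (-1) ^ r * negPow q (r + 1) * (1 - B) * f 0 (r + 1) +
      (1 - B * negPow q (r + 1)) * f 2 (r + 1)] := rfl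

theorem modelX1_apply (q A : k) (f : ModelSpace k) :
    modelX1 q A f = ![fun r => (-1) ^ r * (1 - A) * f 3 r,
    fun r => (1 - A * negPow q (r + 1)) * f 0 (r + 1) + (-1) ^ r * (1 - A) * f 2 (r + 1),
    fun r => (1 - A * negPow q r) * f 3 r, 0] := rfl

theorem modelY0_apply (f : ModelSpace k) :
    modelY0 k f = ![0, f 0, fun r => f 3 (r - 1), 0] := rfl

theorem modelY1_apply (f : ModelSpace k) :
    modelY1 k f = ![fun r => f 1 (r - 1), 0, 0, f 2] := rfl

theorem modelDiag_apply (d : Fin 4 → ℤ → k) (f : ModelSpace k) (c : Fin 4) (r : ℤ) :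
    modelDiag d f c r = d c r * f c r := rfl

theorem modelK0_mul_X0 {q : k} (hq : q ≠ 0) (A B : k) :
    modelDiag (modelK0 q A) * modelX0 q B = q • (modelX0 q B * modelDiag (modelK0 q A)) := by
  refine LinearMap.ext fun f => funext fun c => funext fun r => ?_
  fin_cases c <;>
    simp [modelDiag_apply, modelX0_apply, modelK0, negPow_add_one hq] <;> field_simp

theorem modelK1_mul_X1 {q : k} (hq : q ≠ 0) (A B : k) :
    modelDiag (modelK1 q B) * modelX1 q A = q • (modelX1 q A * modelDiag (modelK1 q B)) := by
  refine LinearMap.ext fun f => funext fun c => funext fun r => ?_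
  fin_cases c <;>
    simp [modelDiag_apply, modelX1_apply, modelK1, negPow_add_one hq] <;> field_simp

theorem modelK0_mul_X1 {q : k} (hq : q ≠ 0) (A : k) :
    modelDiag (modelK0 q A) * modelX1 q A = modelX1 q A * modelDiag (modelK0 q A) := by
  refine LinearMap.ext fun f => funext fun c => funext fun r => ?_
  fin_cases c <;>
    simp [modelDiag_apply, modelX1_apply, modelK0, negPow_add_one hq] <;> ring

theorem modelK1_mul_X0 {q : k} (hq : q ≠ 0) (B : k) :
    modelDiag (modelK1 q B) * modelX0 q B = modelX0 q B * modelDiag (modelK1 q B) := by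
  refine LinearMap.ext fun f => funext fun c => funext fun r => ?_
  fin_cases c <;>
    simp [modelDiag_apply, modelX0_apply, modelK1, negPow_add_one hq] <;> ring

theorem modelK0_mul_Y0 {q : k} (hq : q ≠ 0) (A : k) :
    modelDiag (modelK0 q A) * modelY0 k = q⁻¹ • (modelY0 k * modelDiag (modelK0 q A)) := by
  refine LinearMap.ext fun f => funext fun c => funext fun r => ?_
  fin_cases c <;>
    simp [modelDiag_apply, modelY0_apply, modelK0, negPow_add_one hq, negPow_sub_one hq] <;>
    field_simp

theorem modelK1_mul_Y1 {q : k} (hq : q ≠ 0) (B : k) :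
    modelDiag (modelK1 q B) * modelY1 k = q⁻¹ • (modelY1 k * modelDiag (modelK1 q B)) := by
  refine LinearMap.ext fun f => funext fun c => funext fun r => ?_
  fin_cases c <;>
    simp [modelDiag_apply, modelY1_apply, modelK1, negPow_add_one hq, negPow_sub_one hq] <;>
    field_simp

theorem modelK0_mul_Y1 {q : k} (A : k) :
    modelDiag (modelK0 q A) * modelY1 k = modelY1 k * modelDiag (modelK0 q A) := by
  refine LinearMap.ext fun f => funext fun c => funext fun r => ?_
  fin_cases c <;> simp [modelDiag_apply, modelY1_apply, modelK0]

theorem modelK1_mul_Y0 {q : k} (B : k) :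
    modelDiag (modelK1 q B) * modelY0 k = modelY0 k * modelDiag (modelK1 q B) := by
  refine LinearMap.ext fun f => funext fun c => funext fun r => ?_
  fin_cases c <;> simp [modelDiag_apply, modelY0_apply, modelK1]

theorem modelY0_mul_X0 (q B : k) :
    modelY0 k * modelX0 q B + modelX0 q B * modelY0 k = 1 - modelDiag (modelK1 q B) := by
  refine LinearMap.ext fun f => funext fun c => funext fun r => ?_
  fin_cases c <;>
    simp [modelDiag_apply, modelX0_apply, modelY0_apply, modelK1, neg_one_zpow_sub_one] <;> ring

theorem modelY1_mul_X1 (q A : k) :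
    modelY1 k * modelX1 q A + modelX1 q A * modelY1 k = 1 - modelDiag (modelK0 q A) := by
  refine LinearMap.ext fun f => funext fun c => funext fun r => ?_
  fin_cases c <;>
    simp [modelDiag_apply, modelX1_apply, modelY1_apply, modelK0, neg_one_zpow_sub_one] <;> ring

theorem modelY0_mul_X1 (q A : k) : modelY0 k * modelX1 q A = modelX1 q A * modelY0 k := by
  refine LinearMap.ext fun f => funext fun c => funext fun r => ?_
  fin_cases c <;>
    simp [modelX1_apply, modelY0_apply]

theorem modelY1_mul_X0 {q : k} (hq : q ≠ 0) (B : k) :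
    modelY1 k * modelX0 q B = q • (modelX0 q B * modelY1 k) := by
  refine LinearMap.ext fun f => funext fun c => funext fun r => ?_
  fin_cases c <;>
    simp [modelX0_apply, modelY1_apply, negPow_add_one hq] <;> field_simp

theorem modelX0_mul_self (q B : k) : modelX0 q B * modelX0 q B = 0 := by
  refine LinearMap.ext fun f => funext fun c => funext fun r => ?_
  fin_cases c <;> simp [modelX0_apply, neg_one_zpow_add_one]
  ring

theorem modelX1_mul_self (q A : k) : modelX1 q A * modelX1 q A = 0 := by
  refine LinearMap.ext fun f => funext fun c => funext fun r => ?_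
  fin_cases c <;> simp [modelX1_apply, neg_one_zpow_add_one]
  ring

theorem modelY0_mul_self : modelY0 k * modelY0 k = 0 := by
  refine LinearMap.ext fun f => funext fun c => funext fun r => ?_
  fin_cases c <;> simp [modelY0_apply]

theorem modelY1_mul_self : modelY1 k * modelY1 k = 0 := by
  refine LinearMap.ext fun f => funext fun c => funext fun r => ?_
  fin_cases c <;> simp [modelY1_apply]

theorem modelShift_pow (m : ℤ) (j : ℕ) : modelShift k m ^ j = modelShift k (j * m) := by
  induction j with
  | zero =>
    refine LinearMap.ext fun f => funext fun c => funext fun r => ?_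
    simp [modelShift_apply]
  | succ j ih =>
    rw [pow_succ, ih]
    refine LinearMap.ext fun f => funext fun c => funext fun r => ?_
    rw [Module.End.mul_apply, modelShift_apply, modelShift_apply, modelShift_apply]
    congr 1
    push_cast
    ring

theorem modelY_mul_add : modelY0 k * modelY1 k + modelY1 k * modelY0 k = modelShift k (-1) := by
  refine LinearMap.ext fun f => funext fun c => funext fun r => ?_
  fin_cases c <;> simp [modelY0_apply, modelY1_apply, modelShift_apply, sub_eq_add_neg]

/-- For m = N this is the one relation that fails on the model: the power of y_12 is a shift by N
steps instead of zero. The subquotient taken later is chosen to kill it. -/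
theorem modelY_pow_add {m : ℕ} (hm : m ≠ 0) :
    (modelY0 k * modelY1 k) ^ m + (modelY1 k * modelY0 k) ^ m = modelShift k (-m) := by
  rw [← add_pow_of_mul_eq_zero _ _ hm, modelY_mul_add, modelShift_pow, mul_neg_one]
  · rw [mul_assoc, ← mul_assoc (modelY1 k), modelY1_mul_self, zero_mul, mul_zero]
  · rw [mul_assoc, ← mul_assoc (modelY0 k), modelY0_mul_self, zero_mul, mul_zero]

/-- The eigenvalues of `x_2 x_1` and `x_1 x_2`. -/
def modelEig (q A B : k) (r : ℤ) : k := (1 - negPow q r) * (1 - A * B * negPow q r)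

/-- One application of x_2 x_1 passes through both families of words; with p = q^{-r} the
contributions combine by (1 - Ap)(1 - Bp) - (1 - A)(1 - B)p = (1 - p)(1 - ABp). -/
theorem modelX10_pow {q : k} (A B : k) (j : ℕ) (f : ModelSpace k) (r : ℤ) :
    ((modelX1 q A * modelX0 q B) ^ j) f 1 r =
      (∏ t ∈ Finset.range j, modelEig q A B (r + 1 + t)) * f 1 (r + j) := by
  induction j generalizing r with
  | zero => simp
  | succ j ih =>
    have h : ∀ (g : ModelSpace k) r, (modelX1 q A * modelX0 q B) g 1 r =
        modelEig q A B (r + 1) * g 1 (r + 1) := by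
      intro g r
      have h1 := neg_one_zpow_mul_self (k := k) r
      simp only [Module.End.mul_apply, modelX1_apply, modelX0_apply, Matrix.cons_val,
        neg_one_zpow_add_one, modelEig]
      linear_combination (-(1 - A) * negPow q (r + 1) * (1 - B) * g 1 (r + 1)) * h1
    rw [pow_succ', Module.End.mul_apply, h, ih, Finset.prod_range_succ', ← mul_assoc]
    congr 1
    · rw [mul_comm]
      congr 1
      · refine Finset.prod_congr rfl fun t _ => ?_
        congr 1
        push_cast
        ring
      · simp
    · congr 1
      push_cast
      ring

theorem modelX01_pow {q : k} (A B : k) (j : ℕ) (f : ModelSpace k) (r : ℤ) :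
    ((modelX0 q B * modelX1 q A) ^ j) f 3 r =
      (∏ t ∈ Finset.range j, modelEig q A B (r + 1 + t)) * f 3 (r + j) := by
  induction j generalizing r with
  | zero => simp
  | succ j ih =>
    have h : ∀ (g : ModelSpace k) r, (modelX0 q B * modelX1 q A) g 3 r =
        modelEig q A B (r + 1) * g 3 (r + 1) := by
      intro g r
      have h1 := neg_one_zpow_mul_self (k := k) r
      simp only [Module.End.mul_apply, modelX1_apply, modelX0_apply, Matrix.cons_val,
        neg_one_zpow_add_one, modelEig]
      linear_combination (-(1 - A) * negPow q (r + 1) * (1 - B) * g 3 (r + 1)) * h1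
    rw [pow_succ', Module.End.mul_apply, h, ih, Finset.prod_range_succ', ← mul_assoc]
    congr 1
    · rw [mul_comm]
      congr 1
      · refine Finset.prod_congr rfl fun t _ => ?_
        congr 1
        push_cast
        ring
      · simp
    · congr 1
      push_cast
      ring

variable {q : k} {n : ℕ}

theorem negPow_add_period (hq : IsPrimitiveRoot q (2 * n)) (h0 : q ≠ 0) (r : ℤ) :
    negPow q (r + (2 * n : ℕ)) = negPow q r := by
  rw [negPow, negPow, neg_add, zpow_add₀ h0, zpow_neg q ((2 * n : ℕ) : ℤ), zpow_natCast,
    hq.pow_eq_one, inv_one, mul_one]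

theorem neg_one_zpow_add_period (n : ℕ) (r : ℤ) : (-1 : k) ^ (r + (2 * n : ℕ)) = (-1) ^ r := by
  rw [zpow_add₀ (by simp), zpow_natCast, (even_two_mul n).neg_one_pow, mul_one]

/-- A full period of exponents contains a multiple of N, where the factor 1 - q^{-r} vanishes. -/
theorem modelEig_prod (hn : 1 < n) (hq : IsPrimitiveRoot q (2 * n)) (A B : k) (r : ℤ) :
    ∏ t ∈ Finset.range (2 * n), modelEig q A B (r + t) = 0 := by
  have h0 : q ≠ 0 := hq.ne_zero (by omega)
  refine Finset.prod_eq_zero (i := ((-r) % (2 * n : ℕ)).toNat) ?_ ?_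
  · have h1 := Int.emod_nonneg (-r) (b := ((2 * n : ℕ) : ℤ)) (by omega)
    have h2 := Int.emod_lt_of_pos (-r) (b := ((2 * n : ℕ) : ℤ)) (by omega)
    rw [Finset.mem_range]
    omega
  · have h1 := Int.emod_nonneg (-r) (b := ((2 * n : ℕ) : ℤ)) (by omega)
    have h2 : negPow q (r + (((-r) % (2 * n : ℕ)).toNat : ℕ)) = 1 := by
      rw [Int.toNat_of_nonneg h1, negPow, Int.emod_def,
        show -(r + (-r - ((2 * n : ℕ) : ℤ) * (-r / ((2 * n : ℕ) : ℤ)))) =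
          ((2 * n : ℕ) : ℤ) * (-r / ((2 * n : ℕ) : ℤ)) by ring, zpow_mul, zpow_natCast,
        hq.pow_eq_one, one_zpow]
    rw [modelEig, h2, sub_self, zero_mul]

/-- On odd words one summand is zero and the other is a product over a full period. On even words
neither need vanish alone: the sum supplies the missing factor of such a product. -/
theorem modelX_pow_add (hn : 1 < n) (hq : IsPrimitiveRoot q (2 * n)) (A B : k) :
    (modelX0 q B * modelX1 q A) ^ (2 * n) + (modelX1 q A * modelX0 q B) ^ (2 * n) = 0 := by
  have h0 : q ≠ 0 := hq.ne_zero (by omega)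
  obtain ⟨j, hj⟩ : ∃ j, 2 * n = j + 1 := ⟨2 * n - 1, by omega⟩
  have hper : ∀ r, negPow q (r + j + 1) = negPow q r := fun r => by
    rw [add_assoc, ← negPow_add_period hq h0 r, hj]
    simp
  have hsgn : ∀ r : ℤ, (-1 : k) ^ (r + j) = -(-1) ^ r := fun r => by
    have := neg_one_zpow_add_period (k := k) n r
    rw [hj, Nat.cast_add_one, ← add_assoc, neg_one_zpow_add_one] at this
    rw [← this, neg_neg]
  -- This brings even components back to powers on odd components, where the action is diagonal up
  -- to a shift; j = N - 1.
  have hsplit : ∀ a b : Module.End k (ModelSpace k), (a * b) ^ (j + 1) = a * (b * a) ^ j * b := by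
    intro a b
    rw [pow_succ]
    have h : SemiconjBy a (b * a) (a * b) := by rw [SemiconjBy, mul_assoc]
    rw [← mul_assoc, ← (h.pow_right j).eq]
  have hprod : ∀ r : ℤ, modelEig q A B r *
      ∏ t ∈ Finset.range j, modelEig q A B (r + 1 + t) = 0 := by
    intro r
    have := modelEig_prod hn hq A B r
    rw [hj, Finset.prod_range_succ', mul_comm, Nat.cast_zero, add_zero] at this
    rw [← this]
    congr 1
    refine Finset.prod_congr rfl fun t _ => ?_
    congr 1
    push_cast
    ring
  refine LinearMap.ext fun f => funext fun c => funext fun r => ?_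
  have hs := neg_one_zpow_mul_self (k := k) r
  rw [LinearMap.add_apply, Pi.add_apply, Pi.add_apply, LinearMap.zero_apply, Pi.zero_apply,
    Pi.zero_apply]
  have hp := hprod r
  rw [modelEig] at hp
  fin_cases c
  · rw [hj, hsplit, hsplit]
    change (1 - B * negPow q r) * ((modelX1 q A * modelX0 q B) ^ j) (modelX1 q A f) 1 r +
      (-1) ^ r * (1 - A) * ((modelX0 q B * modelX1 q A) ^ j) (modelX0 q B f) 3 r = 0
    rw [modelX10_pow, modelX01_pow]
    simp only [modelX1_apply, modelX0_apply, Matrix.cons_val, hper, hsgn]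
    linear_combination f 0 (r + j + 1) * hp - (1 - A) * (1 - B) * negPow q r *
      (∏ t ∈ Finset.range j, modelEig q A B (r + 1 + t)) * f 0 (r + j + 1) * hs
  · have h1 : ((modelX0 q B * modelX1 q A) ^ (2 * n)) f 1 r = 0 := by
      rw [hj, pow_succ', mul_assoc, Module.End.mul_apply, modelX0_apply]
      rfl
    have h2 := modelX10_pow (q := q) A B (2 * n) f r
    rw [modelEig_prod hn hq, zero_mul] at h2
    exact (congrArg₂ _ h1 h2).trans (add_zero 0)
  · rw [hj, hsplit, hsplit]
    change (-1) ^ r * negPow q r * (1 - B) * ((modelX1 q A * modelX0 q B) ^ j) (modelX1 q A f) 1 r +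
      (1 - A * negPow q r) * ((modelX0 q B * modelX1 q A) ^ j) (modelX0 q B f) 3 r = 0
    rw [modelX10_pow, modelX01_pow]
    simp only [modelX1_apply, modelX0_apply, Matrix.cons_val, hper, hsgn]
    linear_combination f 2 (r + j + 1) * hp - (1 - A) * (1 - B) * negPow q r *
      (∏ t ∈ Finset.range j, modelEig q A B (r + 1 + t)) * f 2 (r + j + 1) * hs
  · have h1 : ((modelX1 q A * modelX0 q B) ^ (2 * n)) f 3 r = 0 := by
      rw [hj, pow_succ', mul_assoc, Module.End.mul_apply, modelX1_apply]
      rfl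
    have h2 := modelX01_pow (q := q) A B (2 * n) f r
    rw [modelEig_prod hn hq, zero_mul] at h2
    exact (congrArg₂ _ h2 h1).trans (add_zero 0)

end Model

/-! ## The standard modules are nonzero -/

section Subquotient

variable {k : Type u} [Field k] {q : k} {n : ℕ}

theorem freeAlgebra_lift_mem_of_stable {W : Type*} [AddCommGroup W] [Module k W]
    (g : Gen → Module.End k W) (P : Submodule k W) (h : ∀ i, ∀ u ∈ P, g i u ∈ P)
    (f : FreeAlgebra k Gen) {u : W} (hu : u ∈ P) : FreeAlgebra.lift k g f u ∈ P := by
  induction f using FreeAlgebra.induction generalizing u with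
  | grade0 r =>
    rw [AlgHom.commutes, Module.algebraMap_end_apply]
    exact P.smul_mem _ hu
  | grade1 i =>
    rw [FreeAlgebra.lift_ι_apply]
    exact h i u hu
  | mul f g hf hg =>
    rw [map_mul, Module.End.mul_apply]
    exact hf (hg hu)
  | add f g hf hg =>
    rw [map_add, LinearMap.add_apply]
    exact P.add_mem (hf hu) (hg hu)

/-- A subquotient of a representation of the free algebra on which the relations of `u_q` hold is a
`u_q`-module. -/
theorem exists_module_of_subquotient {W : Type u} [AddCommGroup W] [Module k W]
    (ρ : FreeAlgebra k Gen →ₐ[k] Module.End k W) (P T : Submodule k W)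
    (hP : ∀ f, ∀ u ∈ P, ρ f u ∈ P) (hT : ∀ f, ∀ u ∈ T, ρ f u ∈ T)
    (hrel : ∀ a b, Rel q n a b → ∀ u ∈ P, ρ a u - ρ b u ∈ T) (w : Weight n) {v : W} (hv : v ∈ P)
    (hvT : v ∉ T) (hx : ∀ i, ρ (fx k i) v ∈ T)
    (hκ : ∀ i, ρ (fκ k i) v - q ^ (w i).val • v ∈ T) :
    ∃ (X : Type u) (_ : AddCommGroup X) (_ : Module k X) (_ : Module (Uq q n) X)
      (_ : IsScalarTower k (Uq q n) X) (u : X), u ≠ 0 ∧ IsHighest q n w u := by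
  let T' : Submodule k P := T.comap P.subtype
  let σ : FreeAlgebra k Gen → Module.End k (P ⧸ T') := fun f =>
    Submodule.mapQ T' T' ((ρ f).restrict (hP f)) fun u hu => hT f u hu
  have hσ : ∀ f (u : P), σ f (Submodule.Quotient.mk u) =
      Submodule.Quotient.mk (⟨ρ f u, hP f u u.2⟩ : P) := fun f u => rfl
  have hσ' : ∀ f (u u' : P), ρ f u = u' →
      σ f (Submodule.Quotient.mk u) = Submodule.Quotient.mk u' := fun f u u' h =>
    (hσ f u).trans (congrArg _ (Subtype.ext h))
  have hext : ∀ {φ ψ : Module.End k (P ⧸ T')},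
      (∀ u : P, φ (Submodule.Quotient.mk u) = ψ (Submodule.Quotient.mk u)) → φ = ψ := by
    intro φ ψ h
    refine LinearMap.ext fun u => ?_
    obtain ⟨u, rfl⟩ := Submodule.Quotient.mk_surjective _ u
    exact h u
  let σ' : FreeAlgebra k Gen →ₐ[k] Module.End k (P ⧸ T') :=
    { toFun := σ
      map_one' := hext fun u => hσ' 1 u u (by simp)
      map_mul' := fun f g => hext fun u =>
        hσ' (f * g) u ⟨ρ f (ρ g u), hP f _ (hP g u u.2)⟩ (by simp)
      map_zero' := hext fun u => hσ' 0 u 0 (by simp)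
      map_add' := fun f g => hext fun u =>
        (hσ' (f + g) u (⟨ρ f u, hP f u u.2⟩ + ⟨ρ g u, hP g u u.2⟩) (by simp)).trans
          (Submodule.Quotient.mk_add T')
      commutes' := fun r => hext fun u =>
        hσ' (algebraMap k _ r) u (r • u) (by simp [Module.algebraMap_end_apply]) }
  let τ : Uq q n →ₐ[k] Module.End k (P ⧸ T') := RingQuot.liftAlgHom k
    ⟨σ', fun a b h => hext fun u => by
      change σ a _ = σ b _
      rw [hσ, hσ, Submodule.Quotient.eq]
      exact hrel a b h u u.2⟩
  have hτ : ∀ f, τ (Uq.mk q n f) = σ f := fun f => RingQuot.liftAlgHom_mkAlgHom_apply k _ _ f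
  let _ : Module (Uq q n) (P ⧸ T') := Module.compHom _ τ.toRingHom
  have hsmul : ∀ (a : Uq q n) (u : P ⧸ T'), a • u = τ a u := fun _ _ => rfl
  refine ⟨P ⧸ T', inferInstance, inferInstance, inferInstance, ⟨fun c a u => ?_⟩,
    Submodule.Quotient.mk ⟨v, hv⟩, ?_, fun i => ?_, fun i => ?_⟩
  · rw [hsmul, hsmul, map_smul, LinearMap.smul_apply]
  · rw [Ne, Submodule.Quotient.mk_eq_zero]
    exact hvT
  · rw [hsmul, Uq.κ, hτ, hσ, ← Submodule.Quotient.mk_smul, Submodule.Quotient.eq]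
    exact hκ i
  · rw [hsmul, Uq.x, hτ, hσ, Submodule.Quotient.mk_eq_zero]
    exact hx i

variable (k) in
/-- The functions supported in `r ≥ 0` with equal coefficients of `a_0` and `b_0`. -/
def modelSub : Submodule k (ModelSpace k) where
  carrier := {f | (∀ c, ∀ r < 0, f c r = 0) ∧ f 0 0 = f 2 0}
  add_mem' h h' := ⟨fun c r hr => by simp [h.1 c r hr, h'.1 c r hr], by simp [h.2, h'.2]⟩
  zero_mem' := ⟨fun _ _ _ => rfl, rfl⟩
  smul_mem' a f h := ⟨fun c r hr => by simp [h.1 c r hr], by simp [h.2]⟩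

/-- The only danger is an x_i crossing from r = 0 to r = -1. There the coefficients of a_0 and b_0
enter with opposite factors, and the condition that they be equal makes them cancel. It reflects
that both stand for the empty word. -/
theorem modelGen_mem_modelSub (A B : k) (i : Gen) {f : ModelSpace k} (h : f ∈ modelSub k) :
    modelGen q A B i f ∈ modelSub k := by
  obtain ⟨h1, h2⟩ := h
  have hshift : ∀ r : ℤ, r < 0 → r = -1 ∨ r + 1 < 0 := fun r hr => by omega
  cases i with
  | x i =>
    fin_cases i
    · refine ⟨fun c r hr => ?_, ?_⟩
      · have h3 : ∀ c, f c r = 0 := fun c => h1 c r hr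
        fin_cases c
        · simp [modelGen, modelX0_apply, h3]
        · rfl
        · simp [modelGen, modelX0_apply, h3]
        · rcases hshift r hr with rfl | hr'
          · simp [modelGen, modelX0_apply, h2, negPow]
            ring
          · simp [modelGen, modelX0_apply, h1 _ _ hr']
      · simp [modelGen, modelX0_apply, negPow]
    · refine ⟨fun c r hr => ?_, ?_⟩
      · have h3 : ∀ c, f c r = 0 := fun c => h1 c r hr
        fin_cases c
        · simp [modelGen, modelX1_apply, h3]
        · rcases hshift r hr with rfl | hr'
          · simp [modelGen, modelX1_apply, h2, negPow]
            ring
          · simp [modelGen, modelX1_apply, h1 _ _ hr']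
        · simp [modelGen, modelX1_apply, h3]
        · rfl
      · simp [modelGen, modelX1_apply, negPow]
  | y i =>
    have h4 : ∀ c, ∀ r < 0, f c (r - 1) = 0 := fun c r hr => h1 c _ (by omega)
    fin_cases i
    · refine ⟨fun c r hr => ?_, ?_⟩
      · fin_cases c <;> simp [modelGen, modelY0_apply, h1 _ r hr, h4 _ r hr]
      · simp [modelGen, modelY0_apply, h1]
    · refine ⟨fun c r hr => ?_, ?_⟩
      · fin_cases c <;> simp [modelGen, modelY1_apply, h1 _ r hr, h4 _ r hr]
      · simp [modelGen, modelY1_apply, h1]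
  | κ i =>
    fin_cases i
    · refine ⟨fun c r hr => ?_, ?_⟩
      · simp [modelGen, modelDiag_apply, h1 _ r hr]
      · simp [modelGen, modelDiag_apply, modelK0, h2]
    · refine ⟨fun c r hr => ?_, ?_⟩
      · simp [modelGen, modelDiag_apply, h1 _ r hr]
      · simp [modelGen, modelDiag_apply, modelK1, h2]

/-- All coefficients depend on r through q^{-r} and (-1)^r, both of period N. Hence the shifted copy
of the subspace is stable too. -/
theorem modelShift_modelGen (hn : 1 < n) (hq : IsPrimitiveRoot q (2 * n)) (A B : k) (i : Gen)
    (f : ModelSpace k) :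
    modelShift k (2 * n : ℕ) (modelGen q A B i f) =
      modelGen q A B i (modelShift k (2 * n : ℕ) f) := by
  have h0 : q ≠ 0 := hq.ne_zero (by omega)
  have h1 := negPow_add_period hq h0
  have h2 := neg_one_zpow_add_period (k := k) n
  have h3 : ∀ r : ℤ, r + (2 * n : ℕ) + 1 = r + 1 + (2 * n : ℕ) := fun r => by ring
  have h4 : ∀ r : ℤ, r + (2 * n : ℕ) - 1 = r - 1 + (2 * n : ℕ) := fun r => by ring
  refine funext fun c => funext fun r => ?_
  cases i <;> rename_i i <;> fin_cases i <;> fin_cases c <;>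
    simp only [modelGen, modelShift_apply, modelX0_apply, modelX1_apply, modelY0_apply,
      modelY1_apply, modelDiag_apply, modelK0, modelK1, h1, h2, h3, h4, Matrix.cons_val,
      Fin.zero_eta, Fin.mk_one, Fin.reduceFinMk, one_ne_zero, if_true, if_false, Pi.zero_apply]

theorem modelRep_rel (hn : 1 < n) (hq : IsPrimitiveRoot q (2 * n)) {A B : k}
    (hA : A ^ (2 * n) = 1) (hB : B ^ (2 * n) = 1) {a b : FreeAlgebra k Gen} (h : Rel q n a b) :
    modelRep q A B a = modelRep q A B b ∨
      (modelRep q A B a = modelShift k (-(2 * n : ℕ)) ∧ b = 0) := by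
  have h0 : q ≠ 0 := hq.ne_zero (by omega)
  have hx : ∀ i, modelRep q A B (fx k i) = modelGen q A B (Gen.x i) := fun i =>
    FreeAlgebra.lift_ι_apply _ _
  have hy : ∀ i, modelRep q A B (fy k i) = modelGen q A B (Gen.y i) := fun i =>
    FreeAlgebra.lift_ι_apply _ _
  have hκ : ∀ i, modelRep q A B (fκ k i) = modelGen q A B (Gen.κ i) := fun i =>
    FreeAlgebra.lift_ι_apply _ _
  have hneg : ∀ r, negPow q r ^ (2 * n) = 1 := fun r => by
    rw [negPow, ← zpow_natCast, ← zpow_mul, mul_comm, zpow_mul, zpow_natCast, hq.pow_eq_one,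
      one_zpow]
  have hK : ∀ i, modelGen q A B (Gen.κ i) ^ (2 * n) = 1 := by
    intro i
    fin_cases i
    · change modelDiag (modelK0 q A) ^ (2 * n) = 1
      rw [modelDiag_pow]
      refine LinearMap.ext fun f => funext fun c => funext fun r => ?_
      rw [modelDiag_apply]
      fin_cases c <;> simp [modelK0, mul_pow, hA, hneg]
    · change modelDiag (modelK1 q B) ^ (2 * n) = 1
      rw [modelDiag_pow]
      refine LinearMap.ext fun f => funext fun c => funext fun r => ?_
      rw [modelDiag_apply]
      fin_cases c <;> simp [modelK1, mul_pow, hB, hneg]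
  have hK2 : ∀ i, modelGen q A B (Gen.κ i) ^ n * modelGen q A B (Gen.κ i) ^ n = 1 := fun i => by
    rw [← pow_add, ← two_mul, hK]
  have hsm : ∀ T : Module.End k (ModelSpace k), (-1 : k) • T = -T := fun T =>
    LinearMap.ext fun f => neg_one_smul k (T f)
  cases h with
  | κ_x_same i =>
    left
    rw [map_smul, map_mul, map_mul, hκ, hx]
    fin_cases i
    · exact modelK0_mul_X0 h0 A B
    · exact modelK1_mul_X1 h0 A B
  | κ_x_ne i j hij =>
    left
    rw [map_mul, map_mul, hκ, hx]
    fin_cases i <;> fin_cases j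
    · exact absurd rfl hij
    · exact modelK0_mul_X1 h0 A
    · exact modelK1_mul_X0 h0 B
    · exact absurd rfl hij
  | κ_y_same i =>
    left
    rw [map_smul, map_mul, map_mul, hκ, hy]
    fin_cases i
    · exact modelK0_mul_Y0 h0 A
    · exact modelK1_mul_Y1 h0 B
  | κ_y_ne i j hij =>
    left
    rw [map_mul, map_mul, hκ, hy]
    fin_cases i <;> fin_cases j
    · exact absurd rfl hij
    · exact modelK0_mul_Y1 A
    · exact modelK1_mul_Y0 B
    · exact absurd rfl hij
  | κ_comm i j =>
    left
    have hcomm : ∀ d d' : Fin 4 → ℤ → k,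
        modelDiag d * modelDiag d' = modelDiag d' * modelDiag d := fun d d' =>
      LinearMap.ext fun f => mul_left_comm d d' f
    rw [map_mul, map_mul, hκ, hκ]
    fin_cases i <;> fin_cases j <;> exact hcomm _ _
  | κ_pow i =>
    left
    rw [map_pow, hκ, hK, map_one]
  | y_x_same i =>
    left
    rw [map_sub, map_sub, map_smul, map_mul, map_mul, map_mul, map_one, hx, hy, uMat, if_pos rfl,
      pow_half_eq_neg_one hn hq, hsm, sub_neg_eq_add]
    fin_cases i
    · refine (modelY0_mul_X0 q B).trans ?_
      simp only [fγbar, fγ, uMat, map_mul, map_pow, Fin.zero_eta, if_true, hκ]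
      rw [← mul_assoc, hK2, one_mul]
      simp [modelGen]
    · refine (modelY1_mul_X1 q A).trans ?_
      simp only [fγbar, fγ, uMat, map_mul, map_pow, Fin.mk_one, if_true, hκ, one_ne_zero, if_false]
      rw [mul_assoc, hK2, mul_one]
      simp [modelGen]
  | y_x_ne i j hij =>
    left
    rw [map_sub, map_smul, map_mul, map_mul, map_zero, hx, hy, sub_eq_zero]
    fin_cases i <;> fin_cases j
    · exact absurd rfl hij
    · exact (modelY0_mul_X1 q A).trans (by simp [uMat, modelGen])
    · exact (modelY1_mul_X0 h0 B).trans (by simp [uMat, modelGen])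
    · exact absurd rfl hij
  | x_sq i =>
    left
    rw [map_pow, hx, sq, map_zero]
    fin_cases i
    · exact modelX0_mul_self q B
    · exact modelX1_mul_self q A
  | y_sq i =>
    left
    rw [map_pow, hy, sq, map_zero]
    fin_cases i
    · exact modelY0_mul_self
    · exact modelY1_mul_self
  | x12_pow =>
    left
    rw [map_pow, map_sub, map_smul, map_mul, map_mul, hx, hx, map_zero]
    have h1 : q ^ uMat n 0 1 = q := by simp [uMat]
    rw [h1]
    exact (qcommutator_pow hn hq (modelX0_mul_self q B) (modelX1_mul_self q A)).trans
      (modelX_pow_add hn hq A B)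
  | y12_pow =>
    right
    refine ⟨?_, rfl⟩
    rw [map_pow, map_sub, map_smul, map_mul, map_mul, hy, hy]
    have h1 : q ^ uMat n 0 1 = q := by simp [uMat]
    rw [h1]
    exact (qcommutator_pow hn hq modelY0_mul_self modelY1_mul_self).trans
      (modelY_pow_add (by omega))

/-- The module is the quotient of the functions supported in r ≥ 0, with a_0 and b_0 glued, by their
translate starting at r = N. The shift produced by the power of y_12 maps the former into the
latter, so the last relation holds in the quotient. -/
theorem exists_module_with_isHighest (hn : 1 < n) (hq : IsPrimitiveRoot q (2 * n))
    (w : Weight n) :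
    ∃ (X : Type u) (_ : AddCommGroup X) (_ : Module k X) (_ : Module (Uq q n) X)
      (_ : IsScalarTower k (Uq q n) X) (u : X), u ≠ 0 ∧ IsHighest q n w u := by
  have hpow : ∀ m : ℕ, (q ^ m) ^ (2 * n) = 1 := fun m => by
    rw [← pow_mul, mul_comm, pow_mul, hq.pow_eq_one, one_pow]
  set A := q ^ (w 0).val with hA
  set B := q ^ (w 1).val with hB
  have hvals : ∀ r : ℤ, (Pi.single 0 1 : ℤ → k) r = 0 ∨ r = 0 := fun r => by
    by_cases h : r = 0 <;> simp [h]
  -- The vector a_0 + b_0, which plays the role of the empty word.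
  let v : ModelSpace k := ![Pi.single 0 1, 0, Pi.single 0 1, 0]
  refine exists_module_of_subquotient (modelRep q A B) (modelSub k)
    ((modelSub k).comap (modelShift k (2 * n : ℕ)))
    (fun f u hu => freeAlgebra_lift_mem_of_stable _ _
      (fun i u hu => modelGen_mem_modelSub A B i hu) f hu)
    (fun f u hu => freeAlgebra_lift_mem_of_stable _ _ (fun i u hu => ?_) f hu)
    (fun a b hab u hu => ?_) w (v := v) ?_ ?_ (fun i => ?_) (fun i => ?_)
  · rw [Submodule.mem_comap, modelShift_modelGen hn hq]
    exact modelGen_mem_modelSub A B i hu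
  · rcases modelRep_rel hn hq (hpow _) (hpow _) hab with h | ⟨h, rfl⟩
    · rw [h, sub_self]
      exact zero_mem _
    · rw [h, map_zero, LinearMap.zero_apply, sub_zero, Submodule.mem_comap]
      convert hu using 1
      refine funext fun c => funext fun r => ?_
      rw [modelShift_apply, modelShift_apply]
      congr 1
      ring
  · refine ⟨fun c r hr => ?_, rfl⟩
    fin_cases c <;> simp [v, hr.ne]
  · intro h
    -- After the shift the coefficient of a_0, which is 1, sits at r = -N, where members of the
    -- subspace vanish.
    have := h.1 0 (-(2 * n : ℕ)) (by omega)
    rw [modelShift_apply, neg_add_cancel] at this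
    simp [v] at this
  · convert Submodule.zero_mem _ using 1
    have h1 : modelRep q A B (fx k i) = modelGen q A B (Gen.x i) := FreeAlgebra.lift_ι_apply _ _
    rw [h1]
    refine funext fun c => funext fun r => ?_
    fin_cases i
    · fin_cases c
      · simp [modelGen, modelX0_apply, v]
      · simp [modelGen, modelX0_apply, v]
      · simp [modelGen, modelX0_apply, v]
      · rcases hvals (r + 1) with h | h
        · simp [modelGen, modelX0_apply, v, h]
        · obtain rfl : r = -1 := by omega
          simp [modelGen, modelX0_apply, v, negPow]
    · fin_cases c
      · simp [modelGen, modelX1_apply, v]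
      · rcases hvals (r + 1) with h | h
        · simp [modelGen, modelX1_apply, v, h]
        · obtain rfl : r = -1 := by omega
          simp [modelGen, modelX1_apply, v, negPow]
      · simp [modelGen, modelX1_apply, v]
      · simp [modelGen, modelX1_apply, v]
  · convert Submodule.zero_mem _ using 1
    have h1 : modelRep q A B (fκ k i) = modelGen q A B (Gen.κ i) := FreeAlgebra.lift_ι_apply _ _
    rw [h1, sub_eq_zero]
    refine funext fun c => funext fun r => ?_
    rw [Pi.smul_apply, Pi.smul_apply, smul_eq_mul]
    rcases hvals r with h | rfl
    · fin_cases i <;> fin_cases c <;> simp [modelGen, modelDiag_apply, v, h]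
    · fin_cases i <;> fin_cases c <;>
        simp [modelGen, modelDiag_apply, v, modelK0, modelK1, negPow, hA, hB]

theorem stdVec_ne_zero (hn : 1 < n) (hq : IsPrimitiveRoot q (2 * n)) (w : Weight n) :
    stdVec hn hq w ≠ 0 := by
  obtain ⟨X, _, _, _, _, u, hu0, hu⟩ := exists_module_with_isHighest hn hq w
  obtain ⟨f, hf⟩ := exists_stdModule_hom hn hq hu
  intro h
  rw [h, map_zero] at hf
  exact hu0 hf.symm

instance simpleHead_isSimpleModule (hn : 1 < n) (hq : IsPrimitiveRoot q (2 * n)) (w : Weight n) :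
    IsSimpleModule (Uq q n) (SimpleHead hn hq w) :=
  isSimpleModule_iff_isCoatom.mpr (sumProper_stdModule_isCoatom hn hq w (stdVec_ne_zero hn hq w))

theorem headVec_ne_zero (hn : 1 < n) (hq : IsPrimitiveRoot q (2 * n)) (w : Weight n) :
    headVec hn hq w ≠ 0 := by
  intro h
  have h1 := headVec_generates hn hq w
  rw [h, Submodule.span_zero_singleton] at h1
  have : Nontrivial (SimpleHead hn hq w) := IsSimpleModule.nontrivial (Uq q n) _
  exact bot_ne_top h1

end Subquotient

/-! ## The action of the `x_i` on alternating words -/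

section Formulas

set_option linter.unusedSectionVars false

variable {k : Type u} [Field k] {q : k} {n : ℕ}
  {V : Type*} [AddCommGroup V] [Module k V] [Module (Uq q n) V] [IsScalarTower k (Uq q n) V]

theorem y_smul_path_even (v : V) (a : Fin 2) (r : ℕ) :
    Uq.y q n a • path (Uq.y q n) v a (2 * r) = path (Uq.y q n) v a (2 * r + 1) := by
  rw [path, altLetter_two_mul]

theorem y_smul_path_odd (v : V) (a : Fin 2) (r : ℕ) :
    Uq.y q n (a + 1) • path (Uq.y q n) v a (2 * r + 1) = path (Uq.y q n) v a (2 * r + 2) := by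
  rw [path.eq_def _ _ _ (2 * r + 2)]
  simp only [altLetter_two_mul_add_one]

theorem y_smul_path_odd' (v : V) (a : Fin 2) (r : ℕ) :
    Uq.y q n a • path (Uq.y q n) v (a + 1) (2 * r + 1) = path (Uq.y q n) v (a + 1) (2 * r + 2) := by
  have h := y_smul_path_odd (q := q) (n := n) v (a + 1) r
  rwa [fin_two_add_one_add_one] at h

theorem y_smul_path_odd_eq_zero (v : V) (a : Fin 2) (r : ℕ) :
    Uq.y q n a • path (Uq.y q n) v a (2 * r + 1) = 0 := by
  rw [← y_smul_path_even, smul_smul, Uq.y_mul_self, zero_smul]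

theorem y_smul_path_even_eq_zero (v : V) (a : Fin 2) (r : ℕ) :
    Uq.y q n (a + 1) • path (Uq.y q n) v a (2 * r + 2) = 0 := by
  rw [← y_smul_path_odd, smul_smul, Uq.y_mul_self, zero_smul]

theorem x_smul_y_ne' (hn : 1 < n) (hq : IsPrimitiveRoot q (2 * n)) (a : Fin 2) (v : V) :
    Uq.x q n (a + 1) • Uq.y q n a • v =
      exchangeFactor q (a + 1) • Uq.y q n a • Uq.x q n (a + 1) • v := by
  have h := x_smul_y_ne hn hq (a + 1) v
  rwa [fin_two_add_one_add_one] at h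

variable {w : Weight n} {v : V}

theorem IsHighest.κ_smul_path_even (hn : 1 < n) (hq : IsPrimitiveRoot q (2 * n))
    (hv : IsHighest q n w v) (a c : Fin 2) (r : ℕ) :
    Uq.κ q n c • path (Uq.y q n) v a (2 * r) =
      (q ^ (w c).val * q⁻¹ ^ r) • path (Uq.y q n) v a (2 * r) := by
  rw [hv.weight.path hn hq a (2 * r) c, altWeight, pow_val_sub_natCast hn hq]
  congr 3
  split_ifs <;> omega

theorem IsHighest.κ_smul_path_odd (hn : 1 < n) (hq : IsPrimitiveRoot q (2 * n))
    (hv : IsHighest q n w v) (a : Fin 2) (r : ℕ) :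
    Uq.κ q n a • path (Uq.y q n) v a (2 * r + 1) =
      (q ^ (w a).val * q⁻¹ ^ (r + 1)) • path (Uq.y q n) v a (2 * r + 1) := by
  rw [hv.weight.path hn hq a (2 * r + 1) a, altWeight, pow_val_sub_natCast hn hq, if_pos rfl]
  congr 3
  omega

theorem IsHighest.x_smul_path_one (hn : 1 < n) (hq : IsPrimitiveRoot q (2 * n))
    (hv : IsHighest q n w v) (a : Fin 2) :
    Uq.x q n a • path (Uq.y q n) v a 1 = (1 - q ^ (w (a + 1)).val) • v := by
  change Uq.x q n a • Uq.y q n (altLetter a 0) • v = _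
  rw [altLetter_zero, x_smul_y_same hn hq, hv.x_smul, smul_zero, sub_zero, hv.weight, sub_smul,
    one_smul]

/-- A joint induction: the even formula follows from the odd vanishing at the same r, and the next
odd vanishing follows because y_a kills the odd word the even formula produces. -/
theorem IsHighest.x_smul_path_aux (hn : 1 < n) (hq : IsPrimitiveRoot q (2 * n))
    (hv : IsHighest q n w v) (a : Fin 2) (r : ℕ) :
    Uq.x q n (a + 1) • path (Uq.y q n) v a (2 * r + 1) = 0 ∧
    Uq.x q n (a + 1) • path (Uq.y q n) v a (2 * r + 2) =
      (1 - q ^ (w a).val * q⁻¹ ^ (r + 1)) • path (Uq.y q n) v a (2 * r + 1) := by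
  have step : ∀ r, Uq.x q n (a + 1) • path (Uq.y q n) v a (2 * r + 1) = 0 →
      Uq.x q n (a + 1) • path (Uq.y q n) v a (2 * r + 2) =
        (1 - q ^ (w a).val * q⁻¹ ^ (r + 1)) • path (Uq.y q n) v a (2 * r + 1) := by
    intro r h
    rw [← y_smul_path_odd, x_smul_y_same hn hq, h, smul_zero, sub_zero, fin_two_add_one_add_one,
      hv.κ_smul_path_odd hn hq, sub_smul, one_smul]
  induction r with
  | zero =>
    refine ⟨?_, step 0 ?_⟩ <;>
    · rw [← y_smul_path_even, x_smul_y_ne' hn hq]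
      simp [path, hv.x_smul]
  | succ r ih =>
    have h : Uq.x q n (a + 1) • path (Uq.y q n) v a (2 * (r + 1) + 1) = 0 := by
      rw [← y_smul_path_even, x_smul_y_ne' hn hq, mul_add, mul_one, ih.2, smul_comm (Uq.y q n a),
        y_smul_path_odd_eq_zero, smul_zero, smul_zero]
    exact ⟨h, step _ h⟩

/-- `x_b` annihilates the odd words ending in `y_a v`, `a ≠ b`. -/
theorem IsHighest.x_smul_path_odd_ne (hn : 1 < n) (hq : IsPrimitiveRoot q (2 * n))
    (hv : IsHighest q n w v) (a : Fin 2) (r : ℕ) :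
    Uq.x q n (a + 1) • path (Uq.y q n) v a (2 * r + 1) = 0 :=
  (hv.x_smul_path_aux hn hq a r).1

theorem IsHighest.x_smul_path_even_ne (hn : 1 < n) (hq : IsPrimitiveRoot q (2 * n))
    (hv : IsHighest q n w v) (a : Fin 2) (r : ℕ) :
    Uq.x q n (a + 1) • path (Uq.y q n) v a (2 * r + 2) =
      (1 - q ^ (w a).val * q⁻¹ ^ (r + 1)) • path (Uq.y q n) v a (2 * r + 1) :=
  (hv.x_smul_path_aux hn hq a r).2

theorem IsHighest.x_smul_path_odd_of_even (hn : 1 < n) (hq : IsPrimitiveRoot q (2 * n))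
    (hv : IsHighest q n w v) (a : Fin 2) (r : ℕ) {c : k}
    (h : Uq.x q n a • path (Uq.y q n) v a (2 * r + 2) =
      c • path (Uq.y q n) v (a + 1) (2 * r + 1)) :
    Uq.x q n a • path (Uq.y q n) v a (2 * r + 3) =
      (1 - q ^ (w (a + 1)).val * q⁻¹ ^ (r + 1)) • path (Uq.y q n) v a (2 * r + 2) -
        c • path (Uq.y q n) v (a + 1) (2 * r + 2) := by
  rw [show 2 * r + 3 = 2 * (r + 1) + 1 by ring, ← y_smul_path_even, x_smul_y_same hn hq,
    hv.κ_smul_path_even hn hq, show 2 * (r + 1) = 2 * r + 2 by ring, h, smul_comm (Uq.y q n a),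
    y_smul_path_odd', sub_smul, one_smul]

/-- Here x_a crosses to the other branch. In the recursion y_{a+1} kills the term on the branch of
a, so only the other one survives, each round contributing a sign and an exchange factor. -/
theorem IsHighest.x_smul_path_even (hn : 1 < n) (hq : IsPrimitiveRoot q (2 * n))
    (hv : IsHighest q n w v) (a : Fin 2) (r : ℕ) :
    Uq.x q n a • path (Uq.y q n) v a (2 * r + 2) =
      ((-1) ^ r * exchangeFactor q a ^ (r + 1) * (1 - q ^ (w (a + 1)).val)) •
        path (Uq.y q n) v (a + 1) (2 * r + 1) := by
  induction r with
  | zero =>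
    rw [← y_smul_path_odd, x_smul_y_ne hn hq, mul_zero, zero_add, hv.x_smul_path_one hn hq,
      smul_comm (Uq.y q n (a + 1)), smul_smul]
    simp [path, altLetter_zero]
  | succ r ih =>
    rw [← y_smul_path_odd, x_smul_y_ne hn hq, show 2 * (r + 1) + 1 = 2 * r + 3 by ring,
      hv.x_smul_path_odd_of_even hn hq a r ih, smul_sub, smul_comm (Uq.y q n (a + 1)),
      smul_comm (Uq.y q n (a + 1)), y_smul_path_even_eq_zero, smul_zero, zero_sub,
      show 2 * r + 2 = 2 * (r + 1) by ring, y_smul_path_even,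
      show 2 * (r + 1) + 1 = 2 * r + 3 by ring, smul_neg, smul_smul, ← neg_smul]
    congr 1
    ring

theorem IsHighest.x_smul_path_odd (hn : 1 < n) (hq : IsPrimitiveRoot q (2 * n))
    (hv : IsHighest q n w v) (a : Fin 2) (r : ℕ) :
    Uq.x q n a • path (Uq.y q n) v a (2 * r + 3) =
      (1 - q ^ (w (a + 1)).val * q⁻¹ ^ (r + 1)) • path (Uq.y q n) v a (2 * r + 2) -
        ((-1) ^ r * exchangeFactor q a ^ (r + 1) * (1 - q ^ (w (a + 1)).val)) •
          path (Uq.y q n) v (a + 1) (2 * r + 2) :=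
  hv.x_smul_path_odd_of_even hn hq a r (hv.x_smul_path_even hn hq a r)

theorem exchangeFactor_pow_mul (q : k) (a : Fin 2) (r : ℕ) :
    exchangeFactor q a ^ r * exchangeFactor q (a + 1) ^ r = q⁻¹ ^ r := by
  rw [← mul_pow, exchangeFactor_mul]

/-- Although x_a mixes the two branches, applying x_{a+1} returns to the original one, and the
scalar factors by the identity used in the model. The exchange factors enter only through their
product q^{-1}. -/
theorem IsHighest.x_smul_x_smul_path_odd (hn : 1 < n) (hq : IsPrimitiveRoot q (2 * n))
    (hv : IsHighest q n w v) (a : Fin 2) (r : ℕ) :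
    Uq.x q n (a + 1) • Uq.x q n a • path (Uq.y q n) v a (2 * r + 3) =
      ((1 - q⁻¹ ^ (r + 1)) * (1 - q ^ (w a).val * q ^ (w (a + 1)).val * q⁻¹ ^ (r + 1))) •
        path (Uq.y q n) v a (2 * r + 1) := by
  have h1 := hv.x_smul_path_even hn hq (a + 1) r
  rw [fin_two_add_one_add_one] at h1
  rw [hv.x_smul_path_odd hn hq, smul_sub, smul_comm (Uq.x q n (a + 1)),
    smul_comm (Uq.x q n (a + 1)), hv.x_smul_path_even_ne hn hq, h1, smul_smul, smul_smul,
    ← sub_smul]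
  congr 1
  have h2 : ((-1 : k) ^ r) * (-1) ^ r = 1 := by rw [← mul_pow]; simp
  linear_combination (-(1 - q ^ (w (a + 1)).val) * (1 - q ^ (w a).val)) *
    (exchangeFactor_pow_mul q a (r + 1)) - ((1 - q ^ (w (a + 1)).val) * (1 - q ^ (w a).val)) *
    exchangeFactor q a ^ (r + 1) * exchangeFactor q (a + 1) ^ (r + 1) * h2

end Formulas

/-! ## Linear independence of words -/

section Independence

/-- The operator T i detects b i among all vectors of at least its degree, so coefficients vanish by
induction on degree. -/
theorem linearIndependent_of_triangular {K R W ι : Type*} [Field K] [Ring R] [Algebra K R]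
    [AddCommGroup W] [Module K W] [Module R W] [IsScalarTower K R W] (deg : ι → ℕ) (b : ι → W)
    (T : ι → R) (h1 : ∀ i, T i • b i ≠ 0)
    (h2 : ∀ i j, i ≠ j → deg i ≤ deg j → T i • b j = 0) : LinearIndependent K b := by
  rw [linearIndependent_iff']
  intro s g hg
  have key : ∀ d, ∀ i ∈ s, deg i = d → g i = 0 := by
    intro d
    induction d using Nat.strong_induction_on with
    | _ d ih =>
      intro i hi hd
      have h := congrArg (T i • ·) hg
      simp only [smul_zero, Finset.smul_sum] at h
      rw [Finset.sum_eq_single_of_mem i hi] at h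
      · rw [smul_comm] at h
        exact (smul_eq_zero.mp h).resolve_right (h1 i)
      · intro j hj hji
        by_cases hlt : deg j < deg i
        · rw [ih (deg j) (hd ▸ hlt) j hj rfl, zero_smul, smul_zero]
        · rw [smul_comm, h2 i j hji.symm (not_lt.mp hlt), smul_zero]
  exact fun i hi => key _ i hi rfl

variable {R : Type*} [Ring R] {V : Type*} [AddCommGroup V] [Module R V] {t : Fin 2 → R}

theorem wordAct_eq_prod_smul (t : Fin 2 → R) (l : List (Fin 2)) (v : V) :
    wordAct t l v = (l.map t).prod • v := by
  induction l with
  | nil => simp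
  | cons i l ih => rw [wordAct_cons, ih, List.map_cons, List.prod_cons, mul_smul]

/-- The detecting operators: T continues the path by d letters. Its first letter repeats the last
one of the opposite branch at the same length, which is why that word is killed once d and s are
nonzero. -/
theorem exists_path_continuation (ht : ∀ i, t i * t i = 0) (v : V) (a : Fin 2) (s d : ℕ) :
    ∃ T : R, T • path t v a s = path t v a (s + d) ∧
      (∀ b r, T • path t v b (r + 1) = path t v b (r + 1 + d) ∨ T • path t v b (r + 1) = 0) ∧
      (d ≠ 0 → s ≠ 0 → T • path t v (a + 1) s = 0) := by
  suffices h : ∃ l : List (Fin 2), l.length = d ∧ wordAct t l (path t v a s) = path t v a (s + d) ∧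
      (d ≠ 0 → s ≠ 0 → wordAct t l (path t v (a + 1) s) = 0) by
    obtain ⟨l, rfl, h1, h2⟩ := h
    refine ⟨(l.map t).prod, ?_, fun b r => ?_, fun hd hs => ?_⟩
    · rw [← wordAct_eq_prod_smul, h1]
    · rw [← wordAct_eq_prod_smul]
      exact wordAct_path ht v b r l
    · rw [← wordAct_eq_prod_smul, h2 hd hs]
  induction d with
  | zero => exact ⟨[], rfl, rfl, fun h => absurd rfl h⟩
  | succ d ih =>
    obtain ⟨l, hl, h1, h2⟩ := ih
    refine ⟨altLetter a (s + d) :: l, by simp [hl], ?_, fun _ hs => ?_⟩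
    · rw [wordAct_cons, h1]
      rfl
    · rw [wordAct_cons]
      by_cases hd : d = 0
      · subst hd
        obtain rfl := List.length_eq_zero_iff.mp hl
        obtain ⟨s, rfl⟩ := Nat.exists_eq_succ_of_ne_zero hs
        have h := smul_path_altLetter_add_one ht v (a + 1) s
        rwa [altLetter_add_one, fin_two_add_one_add_one] at h
      · rw [h2 hd hs, smul_zero]

theorem path_eq_zero_of_lt {v : V} {a : Fin 2} {l : ℕ} (h : path t v a (l + 1) = 0) {s : ℕ}
    (hs : l < s) : path t v a s = 0 := by
  induction s, hs using Nat.le_induction with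
  | base => exact h
  | succ s _ ih => rw [path, ih, smul_zero]

end Independence


/-! ## The structure of the simple modules -/

section Structure

variable {k : Type u} [Field k] {q : k} {n : ℕ}
  {V : Type u} [AddCommGroup V] [Module k V] [Module (Uq q n) V] [IsScalarTower k (Uq q n) V]
  {w : Weight n} {v : V}

theorem inv_pow_ne_one (hq : IsPrimitiveRoot q (2 * n)) {r : ℕ} (h0 : 0 < r) (h : r < 2 * n) :
    1 - q⁻¹ ^ r ≠ 0 :=
  sub_ne_zero.mpr (hq.inv.pow_ne_one_of_pos_of_lt h0.ne' h).symm

theorem pow_mul_inv_pow (h0 : q ≠ 0) {r m : ℕ} (h : r ≤ m) : q ^ m * q⁻¹ ^ r = q ^ (m - r) := by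
  obtain ⟨d, rfl⟩ := Nat.exists_eq_add_of_le h
  rw [pow_add, mul_comm (q ^ r), mul_assoc, ← mul_pow, mul_inv_cancel₀ h0, one_pow, mul_one,
    Nat.add_sub_cancel_left]

theorem one_sub_pow_mul_inv_pow_ne_zero (hn : 1 < n) (hq : IsPrimitiveRoot q (2 * n)) {r m : ℕ}
    (h : r < m) (hm : m < r + 2 * n) : 1 - q ^ m * q⁻¹ ^ r ≠ 0 := by
  rw [pow_mul_inv_pow (hq.ne_zero (by omega)) h.le]
  exact sub_ne_zero.mpr (hq.pow_ne_one_of_pos_of_lt (by omega) (by omega)).symm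

theorem IsHighest.span_range_eq_top (hn : 1 < n) (hq : IsPrimitiveRoot q (2 * n))
    (hv : IsHighest q n w v) (hgen : Submodule.span (Uq q n) {v} = ⊤) {ι : Type*} (b : ι → V)
    (hb : ∀ a s, path (Uq.y q n) v a s ∈ Submodule.span k (Set.range b)) :
    Submodule.span k (Set.range b) = ⊤ := by
  rw [eq_top_iff, ← hv.wordSpan_eq_top hn hq hgen, wordSpan, Submodule.span_le]
  rintro _ ⟨l, rfl⟩
  rcases wordAct_eq_path (Uq.y_mul_self (q := q) (n := n)) v l with ⟨a, h⟩ | h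
  · simp only [h]
    exact hb _ _
  · simp only [h]
    exact zero_mem _

/-- In a simple module, a word annihilated by the `x_i` is zero. -/
theorem IsHighest.path_eq_zero_of_x_smul (hn : 1 < n) (hq : IsPrimitiveRoot q (2 * n))
    [IsSimpleModule (Uq q n) V] (hv : IsHighest q n w v) (a : Fin 2) (s : ℕ)
    (h : ∀ i, Uq.x q n i • path (Uq.y q n) v a (s + 1) = 0) :
    path (Uq.y q n) v a (s + 1) = 0 :=
  IsHighest.eq_zero_of_mem_yImage hn hq ⟨hv.weight.path hn hq a (s + 1), h⟩
    (path_succ_mem_yImage v a s)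

/-- As w a = 0, the first vector of the branch of a + 1 is a highest weight vector, hence zero. On
the other branch each x_i lowers by one letter, and the first vanishing coefficient, at length 2j +
1, marks the end. -/
theorem IsHighest.isGivenBy_chainDiagram (hn : 1 < n) (hq : IsPrimitiveRoot q (2 * n))
    [IsSimpleModule (Uq q n) V] (hv : IsHighest q n w v) (h0 : v ≠ 0) (a : Fin 2) (hw : w a = 0) :
    IsGivenBy q n V (chainDiagram w a (2 * (w (a + 1)).val)) ∧
      Module.finrank k V = 2 * (w (a + 1)).val + 1 := by
  have : NeZero (2 * n) := ⟨by omega⟩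
  have hq0 : q ≠ 0 := hq.ne_zero (by omega)
  obtain ⟨j, hj⟩ : ∃ j, (w (a + 1)).val = j := ⟨_, rfl⟩
  have hjn : j < 2 * n := hj ▸ ZMod.val_lt _
  have hgen : Submodule.span (Uq q n) {v} = ⊤ := IsSimpleModule.span_singleton_eq_top _ h0
  have hwa : q ^ (w a).val = 1 := by simp [hw]
  rw [hj]
  have hother : ∀ s, path (Uq.y q n) v (a + 1) (s + 1) = 0 := by
    intro s
    refine path_eq_zero_of_lt (l := 0) (hv.path_eq_zero_of_x_smul hn hq _ 0 fun i => ?_)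
      (Nat.succ_pos s)
    rcases fin_two_eq_or a i with rfl | rfl
    · have h := hv.x_smul_path_odd_ne hn hq (i + 1) 0
      rwa [fin_two_add_one_add_one] at h
    · rw [hv.x_smul_path_one hn hq, fin_two_add_one_add_one, hwa, sub_self, zero_smul]
  have hodd : ∀ r, Uq.x q n a • path (Uq.y q n) v a (2 * r + 1) =
      (1 - q ^ j * q⁻¹ ^ r) • path (Uq.y q n) v a (2 * r) := by
    intro r
    rw [← hj]
    cases r with
    | zero =>
      change _ = _ • v
      simpa using hv.x_smul_path_one hn hq a
    | succ r =>
      have h := hv.x_smul_path_odd hn hq a r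
      rwa [hother, smul_zero, sub_zero] at h
  -- Words are lowered by x_a at odd length and by x_{a+1} at even length, with coefficients 1 -
  -- q^{j-r} for r < j and 1 - q^{-(r+1)} for r + 1 ≤ j < N, all nonzero.
  have hne : ∀ s ≤ 2 * j, path (Uq.y q n) v a s ≠ 0 := by
    intro s
    induction s with
    | zero => exact fun _ => h0
    | succ s ih =>
      intro hs h
      have ih' := ih (by omega)
      rcases Nat.even_or_odd' s with ⟨r, rfl | rfl⟩
      · have h1 := hodd r
        rw [h, smul_zero] at h1
        exact (smul_ne_zero (one_sub_pow_mul_inv_pow_ne_zero hn hq (by omega) (by omega)) ih')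
          h1.symm
      · have h1 := hv.x_smul_path_even_ne hn hq a r
        rw [h, smul_zero, hwa, one_mul] at h1
        exact (smul_ne_zero (inv_pow_ne_one hq (by omega) (by omega)) ih') h1.symm
  have hend : path (Uq.y q n) v a (2 * j + 1) = 0 := by
    refine hv.path_eq_zero_of_x_smul hn hq _ _ fun i => ?_
    rcases fin_two_eq_or a i with rfl | rfl
    · rw [hodd, pow_mul_inv_pow hq0 le_rfl, Nat.sub_self, pow_zero, sub_self, zero_smul]
    · exact hv.x_smul_path_odd_ne hn hq a j
  let b : Fin (2 * j + 1) → V := fun s => path (Uq.y q n) v a s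
  have hli : LinearIndependent k b := by
    -- T s continues the word of length s exactly to the end of the path, so it pushes every longer
    -- word past the end.
    choose T hT1 hT2 _ using fun s : Fin (2 * j + 1) =>
      exists_path_continuation (Uq.y_mul_self (q := q) (n := n)) v a s (2 * j - s)
    refine linearIndependent_of_triangular (fun s : Fin (2 * j + 1) => (s : ℕ)) b T (fun s => ?_) ?_
    · change T s • path (Uq.y q n) v a s ≠ 0
      rw [hT1]
      exact hne _ (by omega)
    · intro s s' hss hle
      have hlt : (s : ℕ) < s' := lt_of_le_of_ne hle fun h => hss (Fin.ext h)
      obtain ⟨r, hr⟩ := Nat.exists_eq_succ_of_ne_zero (Nat.ne_of_gt (Nat.zero_lt_of_lt hlt))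
      change T s • path (Uq.y q n) v a s' = 0
      rw [hr]
      rcases hT2 s a r with h | h
      · rw [h]
        exact path_eq_zero_of_lt hend (by omega)
      · exact h
  have hspan : Submodule.span k (Set.range b) = ⊤ := by
    refine hv.span_range_eq_top hn hq hgen b fun c s => ?_
    have hmem : path (Uq.y q n) v a s ∈ Submodule.span k (Set.range b) := by
      by_cases hs : s < 2 * j + 1
      · exact Submodule.subset_span ⟨⟨s, hs⟩, rfl⟩
      · rw [path_eq_zero_of_lt hend (by omega)]
        exact zero_mem _
    rcases fin_two_eq_or a c with rfl | rfl
    · exact hmem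
    · cases s with
      | zero => exact Submodule.subset_span ⟨0, rfl⟩
      | succ s =>
        rw [hother]
        exact zero_mem _
  let B : Module.Basis (Fin (2 * j + 1)) k V := Module.Basis.mk hli hspan.ge
  have hB : ∀ s, B s = path (Uq.y q n) v a s := fun s => Module.Basis.mk_apply _ _ s
  have hlabel : ∀ (p : Fin (2 * j + 1)) i,
      Uq.κ q n i • B p = q ^ (altWeight w a p i).val • B p := by
    intro p i
    rw [hB]
    exact hv.weight.path hn hq a p i
  have hnext : ∀ c (p p' : Fin (2 * j + 1)),
      (chainDiagram w a (2 * j)).next c p = some p' →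
        ∃ d : k, d ≠ 0 ∧ Uq.y q n c • B p = d • B p' := by
    intro c p p' h
    simp only [chainDiagram] at h
    split_ifs at h with hc hlt
    obtain rfl := Option.some.inj h
    refine ⟨1, one_ne_zero, ?_⟩
    rw [hB, hB, one_smul, hc]
    rfl
  have hnone : ∀ c (p : Fin (2 * j + 1)),
      (chainDiagram w a (2 * j)).next c p = none → Uq.y q n c • B p = 0 := by
    intro c p h
    simp only [chainDiagram] at h
    rw [hB]
    split_ifs at h with hc hlt
    · rw [hc, smul_path_altLetter, show (p : ℕ) = 2 * j by omega, hend]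
    · obtain ⟨s, hs⟩ : ∃ s : ℕ, (p : ℕ) = s := ⟨_, rfl⟩
      rw [hs] at hc ⊢
      have hc' := (fin_two_eq_or (altLetter a s) c).resolve_left hc
      cases s with
      | zero =>
        rw [hc', altLetter_zero]
        have := hother 0
        rwa [path, altLetter_zero] at this
      | succ s => rw [hc', smul_path_altLetter_add_one Uq.y_mul_self]
  refine ⟨⟨B, hlabel, fun i => ?_, ?_, hnext, hnone⟩, ?_⟩
  · exact (congrArg _ (hB 0)).trans (hv.x_smul i)
  · exact (congrArg (fun u => Submodule.span (Uq q n) {u}) (hB 0)).trans hgen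
  · rw [Module.finrank_eq_nat_card_basis B, Nat.card_fin]

/-- The words indexed by the vertices of the diagram with two paths. -/
def forkVec (q : k) (n : ℕ) {V : Type u} [AddCommGroup V] [Module (Uq q n) V] (v : V) (m : ℕ) :
    ForkVertex m → V
  | ForkVertex.source => v
  | ForkVertex.branch a p => path (Uq.y q n) v a (p + 1)
  | ForkVertex.sink => path (Uq.y q n) v 0 (2 * m)

/-- The vertices of the diagram with two paths as a sum of finite types. -/
def forkVertexEquiv (m : ℕ) : ForkVertex m ≃ Option (Option (Fin 2 × Fin (2 * m - 1))) where
  toFun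
    | ForkVertex.source => none
    | ForkVertex.sink => some none
    | ForkVertex.branch a p => some (some (a, p))
  invFun
    | none => ForkVertex.source
    | some none => ForkVertex.sink
    | some (some (a, p)) => ForkVertex.branch a p
  left_inv p := by cases p <;> rfl
  right_inv p := by rcases p with _ | _ | ⟨a, p⟩ <;> rfl

instance (m : ℕ) : Fintype (ForkVertex m) := Fintype.ofEquiv _ (forkVertexEquiv m).symm

theorem card_forkVertex {m : ℕ} (hm : 1 ≤ m) : Fintype.card (ForkVertex m) = 4 * m := by
  rw [Fintype.card_congr (forkVertexEquiv m)]
  simp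
  omega

/-- Simplicity is not assumed, so that this also bounds the dimension of M(w), with m = N. -/
theorem IsHighest.span_forkVec (hn : 1 < n) (hq : IsPrimitiveRoot q (2 * n))
    (hv : IsHighest q n w v) (hgen : Submodule.span (Uq q n) {v} = ⊤) {m : ℕ} {c : k}
    (hc : path (Uq.y q n) v 1 (2 * m) = c • path (Uq.y q n) v 0 (2 * m))
    (hend : ∀ a, path (Uq.y q n) v a (2 * m + 1) = 0) :
    Submodule.span k (Set.range (forkVec q n v m)) = ⊤ := by
  refine hv.span_range_eq_top hn hq hgen _ fun a s => ?_
  have hsink : path (Uq.y q n) v 0 (2 * m) ∈ Submodule.span k (Set.range (forkVec q n v m)) :=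
    Submodule.subset_span ⟨ForkVertex.sink, rfl⟩
  rcases lt_trichotomy s (2 * m) with hs | rfl | hs
  · cases s with
    | zero => exact Submodule.subset_span ⟨ForkVertex.source, rfl⟩
    | succ s => exact Submodule.subset_span ⟨ForkVertex.branch a ⟨s, by omega⟩, rfl⟩
  · rcases fin_two_eq_or 0 a with rfl | rfl
    · exact hsink
    · change path (Uq.y q n) v 1 (2 * m) ∈ _
      rw [hc]
      exact Submodule.smul_mem _ _ hsink
  · rw [path_eq_zero_of_lt (hend a) hs]
    exact zero_mem _

theorem IsHighest.isGivenBy_forkDiagram (hn : 1 < n) (hq : IsPrimitiveRoot q (2 * n))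
    [IsSimpleModule (Uq q n) V] (hv : IsHighest q n w v) (h0 : v ≠ 0) (hw : ∀ a, w a ≠ 0) {m : ℕ}
    (hm : 1 ≤ m) (hmn : m ≤ 2 * n) (hmw : (m : ZMod (2 * n)) = w 0 + w 1) :
    IsGivenBy q n V (forkDiagram w m hm) ∧ Module.finrank k V = 4 * m := by
  have hq0 : q ≠ 0 := hq.ne_zero (by omega)
  have hgen : Submodule.span (Uq q n) {v} = ⊤ := IsSimpleModule.span_singleton_eq_top _ h0
  have hC : ∀ a, 1 - q ^ (w a).val ≠ 0 := fun a =>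
    sub_ne_zero.mpr (pow_val_ne_one hn hq (hw a)).symm
  have hprod : ∀ a, q ^ (w a).val * q ^ (w (a + 1)).val = q ^ m := by
    have h : q ^ (w 0).val * q ^ (w 1).val = q ^ m := by
      rw [← pow_val_add hn hq, ← hmw, pow_val_natCast hq]
    intro a
    fin_cases a
    · exact h
    · exact (mul_comm _ _).trans h
  have hex : ∀ a r, exchangeFactor q a ^ r ≠ 0 := by
    intro a r
    refine pow_ne_zero _ ?_
    unfold exchangeFactor
    split_ifs
    · exact inv_ne_zero hq0
    · exact one_ne_zero
  have hsgn : ∀ r : ℕ, (-1 : k) ^ r ≠ 0 := fun r => pow_ne_zero _ (by simp)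
  -- Lowering by two letters multiplies by (1 - q^{-r})(1 - q^{m-r}), nonzero for 0 < r < m ≤ N.
  have hodd : ∀ r < m, ∀ a, path (Uq.y q n) v a (2 * r + 1) ≠ 0 := by
    intro r
    induction r with
    | zero =>
      intro _ a h
      have h1 := hv.x_smul_path_one hn hq a
      rw [h, smul_zero] at h1
      exact smul_ne_zero (hC _) h0 h1.symm
    | succ r ih =>
      intro hr a h
      have h1 := hv.x_smul_x_smul_path_odd hn hq a r
      rw [show 2 * r + 3 = 2 * (r + 1) + 1 by ring, h, smul_zero, smul_zero, hprod] at h1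
      exact smul_ne_zero (mul_ne_zero (inv_pow_ne_one hq (by omega) (by omega))
        (one_sub_pow_mul_inv_pow_ne_zero hn hq (by omega) (by omega))) (ih (by omega) a) h1.symm
  obtain ⟨r, rfl⟩ : ∃ r, m = r + 1 := ⟨m - 1, by omega⟩
  have htop : path (Uq.y q n) v 0 (2 * (r + 1)) ≠ 0 := by
    intro h
    have h1 := hv.x_smul_path_even hn hq 0 r
    rw [show 2 * r + 2 = 2 * (r + 1) by ring, h, smul_zero] at h1
    exact smul_ne_zero (mul_ne_zero (mul_ne_zero (hsgn _) (hex _ _)) (hC _))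
      (hodd r (by omega) _) h1.symm
  set α := (-1) ^ r * exchangeFactor q 0 ^ (r + 1) * (1 - q ^ (w 1).val) with hα
  set β := 1 - q ^ (w 1).val * q⁻¹ ^ (r + 1) with hβ
  have hα0 : α ≠ 0 := mul_ne_zero (mul_ne_zero (hsgn _) (hex _ _)) (hC _)
  have hQ : q ^ (w 0).val * q ^ (w 1).val * q⁻¹ ^ (r + 1) = 1 := by
    have h := hprod 0
    rw [zero_add] at h
    rw [h, pow_mul_inv_pow hq0 le_rfl, Nat.sub_self, pow_zero]
  have hβ0 : β ≠ 0 := by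
    intro h
    refine hC 0 ?_
    have h1 : q ^ (w 1).val * q⁻¹ ^ (r + 1) = 1 := (sub_eq_zero.mp h).symm
    rw [mul_assoc, h1, mul_one] at hQ
    rw [hQ, sub_self]
  -- The ratio β/α is chosen so that x_1 kills the difference. That x_2 kills it as well is the
  -- vanishing of a 2 × 2 determinant with factor 1 - q^{i+j-m} = 0. The difference is then a
  -- highest weight vector in y_1 V + y_2 V, so it is zero.
  have hγ : path (Uq.y q n) v 1 (2 * (r + 1)) =
      (β / α) • path (Uq.y q n) v 0 (2 * (r + 1)) := by
    rw [← sub_eq_zero]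
    have h00 := hv.x_smul_path_even hn hq 0 r
    have h01 := hv.x_smul_path_even_ne hn hq 1 r
    have h10 := hv.x_smul_path_even_ne hn hq 0 r
    have h11 := hv.x_smul_path_even hn hq 1 r
    rw [show (1 : Fin 2) + 1 = 0 from rfl] at h01 h11
    rw [zero_add] at h00 h10
    have hwt : altWeight w 0 (2 * (r + 1)) = altWeight w 1 (2 * (r + 1)) := by
      ext c
      simp only [altWeight]
      rw [show (2 * (r + 1) + 1) / 2 = r + 1 by omega, show 2 * (r + 1) / 2 = r + 1 by omega,
        ite_self, ite_self]
    refine IsHighest.eq_zero_of_mem_yImage hn hq (w := altWeight w 1 (2 * (r + 1)))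
      ⟨(hv.weight.path hn hq 1 _).sub ((hwt ▸ hv.weight.path hn hq 0 _).smul _), fun i => ?_⟩
      (sub_mem (path_succ_mem_yImage v 1 _)
        (Submodule.smul_mem _ _ (path_succ_mem_yImage v 0 _)))
    rw [smul_sub, smul_comm]
    fin_cases i
    · change Uq.x q n 0 • path (Uq.y q n) v 1 (2 * r + 2) -
        (β / α) • Uq.x q n 0 • path (Uq.y q n) v 0 (2 * r + 2) = 0
      rw [h00, h01, smul_smul, div_mul_cancel₀ _ hα0, sub_self]
    · change Uq.x q n 1 • path (Uq.y q n) v 1 (2 * r + 2) -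
        (β / α) • Uq.x q n 1 • path (Uq.y q n) v 0 (2 * r + 2) = 0
      rw [h10, h11, smul_smul, ← sub_smul]
      convert zero_smul k _ using 2
      rw [sub_eq_zero, eq_comm, div_mul_eq_mul_div, div_eq_iff hα0, hα, hβ]
      have h2 : ((-1 : k) ^ r) * (-1) ^ r = 1 := by rw [← mul_pow]; simp
      have h3 := exchangeFactor_pow_mul q 0 (r + 1)
      rw [zero_add] at h3
      linear_combination (q⁻¹ ^ (r + 1) - 1) * hQ -
        (1 - q ^ (w 0).val) * (1 - q ^ (w 1).val) * h3 -
        (1 - q ^ (w 0).val) * (1 - q ^ (w 1).val) * exchangeFactor q 0 ^ (r + 1) *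
          exchangeFactor q 1 ^ (r + 1) * h2
  have hγ0 : β / α ≠ 0 := div_ne_zero hβ0 hα0
  -- The sink ends in both letters: as the end of either branch it is annihilated by the last letter
  -- of that branch.
  have hzero : ∀ c, Uq.y q n c • path (Uq.y q n) v 0 (2 * (r + 1)) = 0 := by
    intro c
    fin_cases c
    · have h := y_smul_path_even_eq_zero (q := q) (n := n) v 1 r
      change Uq.y q n 0 • path (Uq.y q n) v 1 (2 * (r + 1)) = 0 at h
      rw [hγ, smul_comm] at h
      exact (smul_eq_zero.mp h).resolve_left hγ0
    · exact y_smul_path_even_eq_zero v 0 r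
  have htop' : ∀ a, ∃ c : k, c ≠ 0 ∧ path (Uq.y q n) v a (2 * (r + 1)) =
      c • path (Uq.y q n) v 0 (2 * (r + 1)) := by
    intro a
    fin_cases a
    · exact ⟨1, one_ne_zero, (one_smul _ _).symm⟩
    · exact ⟨_, hγ0, hγ⟩
  have hend : ∀ a, path (Uq.y q n) v a (2 * (r + 1) + 1) = 0 := by
    intro a
    obtain ⟨c, -, hc⟩ := htop' a
    rw [path, hc, smul_comm, hzero, smul_zero]
  have hspan := hv.span_forkVec hn hq hgen hγ hend
  have hli : LinearIndependent k (forkVec q n v (r + 1)) := by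
    choose T hT1 hT2 hT3 using fun (a : Fin 2) (s : ℕ) =>
      exists_path_continuation (Uq.y_mul_self (q := q) (n := n)) v a s (2 * (r + 1) - s)
    have hvan : ∀ a s b s', s < s' + 1 →
        T a s • path (Uq.y q n) v b (s' + 1) = 0 := by
      intro a s b s' hss
      rcases hT2 a s b s' with h | h
      · rw [h]
        exact path_eq_zero_of_lt (hend b) (by omega)
      · exact h
    have hpne : ∀ a, path (Uq.y q n) v a (2 * (r + 1)) ≠ 0 := by
      intro a
      obtain ⟨c, hc0, hc⟩ := htop' a
      rw [hc]
      exact smul_ne_zero hc0 htop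
    let deg : ForkVertex (r + 1) → ℕ
      | ForkVertex.source => 0
      | ForkVertex.branch _ p => p + 1
      | ForkVertex.sink => 2 * (r + 1)
    -- Each nonsink vertex is continued to the sink along its own branch; the source may use either
    -- branch, here that of y_1.
    let T' : ForkVertex (r + 1) → Uq q n
      | ForkVertex.source => T 0 0
      | ForkVertex.branch a p => T a (p + 1)
      | ForkVertex.sink => 1
    refine linearIndependent_of_triangular deg _ T' (fun i => ?_) fun i j hij hle => ?_
    · cases i with
      | source =>
        have h := hT1 0 0
        rw [Nat.zero_add, Nat.sub_zero] at h
        exact h ▸ hpne 0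
      | branch a p =>
        have h := hT1 a (p + 1)
        rw [Nat.add_sub_cancel' (by omega)] at h
        exact h ▸ hpne a
      | sink => exact (one_smul (Uq q n) (path (Uq.y q n) v 0 (2 * (r + 1)))).symm ▸ htop
    · cases i with
      | source =>
        cases j with
        | source => exact absurd rfl hij
        | branch b p' => exact hvan 0 0 b p' (by omega)
        | sink => exact hvan 0 0 0 (2 * r + 1) (by omega)
      | branch a p =>
        cases j with
        | source => exact absurd hle (by simp [deg])
        | branch b p' =>
          rcases Nat.lt_or_ge p p' with hlt | hge
          · exact hvan a _ b p' (by omega)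
          · have hpp : p = p' := Fin.ext (le_antisymm (by simpa [deg] using hle) hge)
            subst hpp
            obtain rfl := (fin_two_eq_or a b).resolve_left fun h => hij (by rw [h])
            exact hT3 a (p + 1) (by omega) (by omega)
        | sink => exact hvan a _ 0 (2 * r + 1) (by omega)
      | sink =>
        cases j with
        | source => exact absurd hle (by simp [deg])
        | branch b p' =>
          have : 2 * (r + 1) ≤ p' + 1 := hle
          omega
        | sink => exact absurd rfl hij
  let B : Module.Basis (forkDiagram w (r + 1) hm).Vertex k V := Module.Basis.mk hli hspan.ge
  have hB : ∀ s : (forkDiagram w (r + 1) hm).Vertex, B s = forkVec q n v (r + 1) s := fun s => Module.Basis.mk_apply _ _ s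
  refine ⟨⟨B, fun p i => ?_, fun i => ?_, ?_, fun c p p' h => ?_, fun c p h => ?_⟩, ?_⟩
  · rw [hB]
    cases p with
    | source => exact hv.weight i
    | branch a p => exact hv.weight.path hn hq a _ i
    | sink =>
      have h := hv.weight.path hn hq 0 (2 * (r + 1)) i
      rw [altWeight, show (2 * (r + 1) + 1) / 2 = r + 1 by omega,
        show 2 * (r + 1) / 2 = r + 1 by omega, ite_self] at h
      exact h
  · exact (congrArg _ (hB ForkVertex.source)).trans (hv.x_smul i)
  · exact (congrArg (fun u => Submodule.span (Uq q n) {u}) (hB ForkVertex.source)).trans hgen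
  · rw [hB, hB]
    cases p with
    | source =>
      obtain rfl := Option.some.inj h
      refine ⟨1, one_ne_zero, ?_⟩
      rw [one_smul]
      change _ = Uq.y q n (altLetter c 0) • v
      rw [altLetter_zero]
      rfl
    | branch a p =>
      simp only [forkDiagram, forkNext] at h
      split_ifs at h with hc hlt
      · obtain rfl := Option.some.inj h
        refine ⟨1, one_ne_zero, ?_⟩
        rw [one_smul, hc]
        rfl
      · obtain rfl := Option.some.inj h
        obtain ⟨d, hd0, hd⟩ := htop' a
        refine ⟨d, hd0, ?_⟩
        rw [hc]
        change path (Uq.y q n) v a (p + 1 + 1) = d • path (Uq.y q n) v 0 (2 * (r + 1))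
        rw [← hd]
        congr 1
        omega
    | sink => exact absurd h (by simp [forkDiagram, forkNext])
  · rw [hB]
    cases p with
    | source => exact absurd h (by simp [forkDiagram, forkNext])
    | branch a p =>
      simp only [forkDiagram, forkNext] at h
      split_ifs at h with hc hlt
      rw [(fin_two_eq_or (altLetter a (p + 1)) c).resolve_left hc]
      exact smul_path_altLetter_add_one Uq.y_mul_self v a p
    | sink => exact hzero c
  · rw [Module.finrank_eq_nat_card_basis B]
    change Nat.card (ForkVertex (r + 1)) = _
    rw [Nat.card_eq_fintype_card, card_forkVertex hm]

end Structure

/-! ### Dimension count for i + j = N, one-dimensional modules and the assembled classification -/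

section Consequences

variable {k : Type u} [Field k] {q : k} {n : ℕ}

theorem bijective_of_surjective_of_finrank_eq_card {K R M M' ι : Type*} [Field K] [Ring R]
    [Algebra K R] [AddCommGroup M] [Module K M] [Module R M] [IsScalarTower K R M]
    [AddCommGroup M'] [Module K M'] [Module R M'] [IsScalarTower K R M'] [Fintype ι] {b : ι → M}
    (hspan : Submodule.span K (Set.range b) = ⊤) (f : M →ₗ[R] M') (hf : Function.Surjective f)
    (h : Module.finrank K M' = Fintype.card ι) : Function.Bijective f := by
  have hfin : Module.Finite K M := ⟨hspan ▸ Submodule.fg_span (Set.finite_range _)⟩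
  have hf' : Function.Surjective (f.restrictScalars K) := hf
  have hfin' : Module.Finite K M' := Module.Finite.of_surjective _ hf'
  have hle : Module.finrank K M ≤ Fintype.card ι := by
    rw [← finrank_top, ← hspan]
    exact finrank_range_le_card b
  have heq : Module.finrank K M = Module.finrank K M' :=
    le_antisymm (hle.trans h.ge) (LinearMap.finrank_le_finrank_of_surjective hf')
  exact ⟨(LinearMap.injective_iff_surjective_of_finrank_eq_finrank heq).mpr hf', hf⟩

/-- If `i + j = N` then `M(i,j)` is spanned by as many words as the dimension of `L(i,j)`. -/
theorem mkQ_bijective (hn : 1 < n) (hq : IsPrimitiveRoot q (2 * n)) (w : Weight n)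
    (h : Module.finrank k (SimpleHead hn hq w) = 4 * (2 * n)) :
    Function.Bijective (Submodule.mkQ (sumProper (Uq q n) (StdModule hn hq w))) := by
  have hy := isNilPair_y hn hq
  -- In M(w) the root vector relation itself closes the fork at m = N, with ratio -1.
  have hspan := (stdVec_isHighest hn hq w).span_forkVec hn hq (stdVec_generates hn hq w)
    (m := 2 * n) (c := -1) (by rw [neg_smul, one_smul]; exact path_top hy _ 0)
    (path_eq_zero hn hy _)
  refine bijective_of_surjective_of_finrank_eq_card hspan _ (Submodule.mkQ_surjective _) ?_
  rw [h, card_forkVertex (by omega)]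

/-- Elements of square zero act by zero on a line, so the x_i and y_i do; the relation between x_i
and y_i then forces the κ's to act by 1. -/
theorem nonempty_linearEquiv_of_finrank_one (hn : 1 < n) (hq : IsPrimitiveRoot q (2 * n))
    (V : Type v) [AddCommGroup V] [Module k V] [Module (Uq q n) V] [IsScalarTower k (Uq q n) V]
    (h : Module.finrank k V = 1) : Nonempty (V ≃ₗ[Uq q n] SimpleHead hn hq ![0, 0]) := by
  obtain ⟨v, h0, hv⟩ := finrank_eq_one_iff'.mp h
  have hsq : ∀ a : Uq q n, a * a = 0 → ∀ u : V, a • u = 0 := by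
    intro a ha u
    obtain ⟨d, rfl⟩ := hv u
    obtain ⟨c, hc⟩ := hv (a • v)
    have h1 : (c * c) • v = 0 := by
      rw [mul_smul, hc, smul_comm, hc, smul_smul, ha, zero_smul]
    have h2 : c = 0 := mul_self_eq_zero.mp ((smul_eq_zero.mp h1).resolve_right h0)
    rw [smul_comm, ← hc, h2, zero_smul, smul_zero]
  have hx : ∀ i (u : V), Uq.x q n i • u = 0 := fun i => hsq _ (Uq.x_mul_self i)
  have hκ : ∀ i, Uq.κ q n i • v = v := by
    intro i
    have h1 := x_smul_y_same hn hq (i + 1) v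
    rw [hx, hx, smul_zero, sub_zero, fin_two_add_one_add_one] at h1
    exact (sub_eq_zero.mp h1.symm).symm
  have hw : ∀ i : Fin 2, (![0, 0] : Weight n) i = 0 := by
    intro i
    fin_cases i <;> rfl
  have : Nontrivial V := ⟨v, 0, h0⟩
  have : IsSimpleModule (Uq q n) V := by
    refine isSimpleModule_iff_toSpanSingleton_surjective.mpr ⟨inferInstance, fun u hu z => ?_⟩
    obtain ⟨d, rfl⟩ := hv u
    obtain ⟨e, rfl⟩ := hv z
    have hd : d ≠ 0 := by
      rintro rfl
      exact hu (zero_smul _ _)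
    refine ⟨algebraMap k _ (e * d⁻¹), ?_⟩
    rw [LinearMap.toSpanSingleton_apply, algebraMap_smul, smul_smul, mul_assoc,
      inv_mul_cancel₀ hd, mul_one]
  refine nonempty_linearEquiv_simpleHead hn hq (v := v) ⟨fun i => ?_, fun i => hx i v⟩ h0
  rw [hκ, hw, ZMod.val_zero, pow_zero, one_smul]

theorem nonempty_linearEquiv_tensorUnit (hn : 1 < n) (hq : IsPrimitiveRoot q (2 * n)) :
    Nonempty (SimpleHead hn hq ![0, 0] ≃ₗ[Uq q n] TensorUnit hn q) := by
  let _ : Module k (TensorUnit hn q) := inferInstanceAs (Module k k)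
  have : IsScalarTower k (Uq q n) (TensorUnit hn q) := ⟨fun c a u => by
    exact (congrArg (fun z : k => z * (show k from u)) (map_smul (counit hn q) c a)).trans
      (mul_assoc c _ _)⟩
  have h : Module.finrank k (TensorUnit hn q) = 1 := Module.finrank_self k
  exact (nonempty_linearEquiv_of_finrank_one hn hq (TensorUnit hn q) h).map LinearEquiv.symm

theorem eq_of_simpleHead_linearEquiv (hn : 1 < n) (hq : IsPrimitiveRoot q (2 * n))
    {w w' : Weight n} (φ : SimpleHead hn hq w ≃ₗ[Uq q n] SimpleHead hn hq w') : w = w' :=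
  eq_of_linearEquiv hn hq (headVec_isHighest hn hq w) (headVec_isHighest hn hq w')
    (headVec_generates hn hq w) (headVec_generates hn hq w') (headVec_ne_zero hn hq w)
    (headVec_ne_zero hn hq w') φ

theorem simpleHead_isGivenBy_chainDiagram (hn : 1 < n) (hq : IsPrimitiveRoot q (2 * n))
    (w : Weight n) (a : Fin 2) (hw : w a = 0) :
    IsGivenBy q n (SimpleHead hn hq w) (chainDiagram w a (2 * (w (a + 1)).val)) ∧
      Module.finrank k (SimpleHead hn hq w) = 2 * (w (a + 1)).val + 1 :=
  (headVec_isHighest hn hq w).isGivenBy_chainDiagram hn hq (headVec_ne_zero hn hq w) a hw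

theorem simpleHead_isGivenBy_forkDiagram (hn : 1 < n) (hq : IsPrimitiveRoot q (2 * n))
    {i j : ZMod (2 * n)} (hi : i ≠ 0) (hj : j ≠ 0) {m : ℕ}
    (hm : 1 ≤ m) (hmn : m ≤ 2 * n) (hmw : (m : ZMod (2 * n)) = i + j) :
    IsGivenBy q n (SimpleHead hn hq ![i, j]) (forkDiagram ![i, j] m hm) ∧
      Module.finrank k (SimpleHead hn hq ![i, j]) = 4 * m :=
  (headVec_isHighest hn hq _).isGivenBy_forkDiagram hn hq (headVec_ne_zero hn hq _)
    (fun a => by fin_cases a <;> assumption) hm hmn hmw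

end Consequences

end SuperA

theorem mainTheorem5 {k : Type u} [Field k] [IsAlgClosed k] [CharZero k]
    {n : ℕ} (hn : 1 < n) {q : k} (hq : IsPrimitiveRoot q (2 * n)) :
    -- the modules `L(i,j)` are a complete list of pairwise non-isomorphic simple modules
    (∀ w : Weight n, IsSimpleModule (Uq q n) (SimpleHead hn hq w)) ∧
    (∀ w w' : Weight n,
      Nonempty (SimpleHead hn hq w ≃ₗ[Uq q n] SimpleHead hn hq w') → w = w') ∧
    (∀ (V : Type v) [AddCommGroup V] [Module (Uq q n) V], IsSimpleModule (Uq q n) V →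
      ∃ w : Weight n, Nonempty (V ≃ₗ[Uq q n] SimpleHead hn hq w)) ∧
    -- (1) the tensor unit, and the unique one-dimensional module
    (Nonempty (SimpleHead hn hq ![0, 0] ≃ₗ[Uq q n] TensorUnit hn q) ∧
      IsGivenBy q n (SimpleHead hn hq ![0, 0]) (chainDiagram ![0, 0] 0 0) ∧
      Module.finrank k (SimpleHead hn hq ![0, 0]) = 1 ∧
      ∀ (V : Type v) [AddCommGroup V] [Module k V] [Module (Uq q n) V]
        [IsScalarTower k (Uq q n) V], Module.finrank k V = 1 →
        Nonempty (V ≃ₗ[Uq q n] SimpleHead hn hq ![0, 0])) ∧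
    -- (2) the modules `L(0,j)`
    (∀ j : ZMod (2 * n), j ≠ 0 →
      IsGivenBy q n (SimpleHead hn hq ![0, j]) (chainDiagram ![0, j] 0 (2 * j.val)) ∧
      Module.finrank k (SimpleHead hn hq ![0, j]) = 2 * j.val + 1) ∧
    -- (3) the modules `L(i,0)`
    (∀ i : ZMod (2 * n), i ≠ 0 →
      IsGivenBy q n (SimpleHead hn hq ![i, 0]) (chainDiagram ![i, 0] 1 (2 * i.val)) ∧
      Module.finrank k (SimpleHead hn hq ![i, 0]) = 2 * i.val + 1) ∧
    -- (4) the modules `L(i,j)` with `i, j ≠ 0`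
    (∀ i j : ZMod (2 * n), i ≠ 0 → j ≠ 0 →
      ∀ (m : ℕ) (hm : 1 ≤ m), m ≤ 2 * n → (m : ZMod (2 * n)) = i + j →
        IsGivenBy q n (SimpleHead hn hq ![i, j]) (forkDiagram ![i, j] m hm) ∧
        (forkDiagram ![i, j] m hm).label ForkVertex.sink = ![-j, -i] ∧
        Module.finrank k (SimpleHead hn hq ![i, j]) = 4 * m) ∧
    (∀ i j : ZMod (2 * n), i ≠ 0 → j ≠ 0 → i.val + j.val = 2 * n →
      Function.Bijective
        (Submodule.mkQ (sumProper (Uq q n) (StdModule hn hq ![i, j])))) := by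
  refine ⟨fun w => inferInstance, fun w w' ⟨φ⟩ => eq_of_simpleHead_linearEquiv hn hq φ,
    fun V _ _ hV => exists_linearEquiv_simpleHead hn hq V hV,
    ⟨nonempty_linearEquiv_tensorUnit hn hq, ?_, ?_,
      fun V _ _ _ _ h => nonempty_linearEquiv_of_finrank_one hn hq V h⟩,
    fun j _ => simpleHead_isGivenBy_chainDiagram hn hq ![0, j] 0 rfl,
    fun i _ => simpleHead_isGivenBy_chainDiagram hn hq ![i, 0] 1 rfl,
    fun i j hi hj m hm hmn hmw => ?_, fun i j hi hj hij => ?_⟩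
  · have h := (simpleHead_isGivenBy_chainDiagram hn hq ![0, 0] 0 rfl).1
    have h0 : 2 * ((![0, 0] : Weight n) (0 + 1)).val = 0 := by simp
    rwa [h0] at h
  · have h := (simpleHead_isGivenBy_chainDiagram hn hq ![0, 0] 0 rfl).2
    have h0 : 2 * ((![0, 0] : Weight n) (0 + 1)).val = 0 := by simp
    rwa [h0] at h
  · have h := simpleHead_isGivenBy_forkDiagram hn hq hi hj hm hmn hmw
    refine ⟨h.1, funext fun c => ?_, h.2⟩
    change (![i, j] : Weight n) c - (m : ZMod (2 * n)) = _
    rw [hmw]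
    fin_cases c <;> simp
  · have : NeZero (2 * n) := ⟨by omega⟩
    -- Here i + j is zero modulo N, and its representative between 1 and N is N itself.
    have hsum : ((2 * n : ℕ) : ZMod (2 * n)) = i + j := by
      refine (congrArg (Nat.cast (R := ZMod (2 * n))) hij.symm).trans ?_
      rw [Nat.cast_add, ZMod.natCast_zmod_val, ZMod.natCast_zmod_val]
    exact mkQ_bijective hn hq _
      (simpleHead_isGivenBy_forkDiagram hn hq hi hj (by omega) le_rfl hsum).2
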